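/- **Setting.** Consider a two-player zero-sum episodic Markov game with simultaneous moves: a measurable state space $\mathcal S$, finite action sets $\mathcal A$ (player 1) and $\mathcal B$ (player 2), horizon $H$, deterministic rewards $r_h:\mathcal S\times\mathcal A\times\mathcal B\to[-1,1]$ and transition kernels $\mathbb P_h(\cdot\mid x,a,b)$, $h\in[H]$. For (Markov, stochastic) policies $\pi,\nu$ of the two players let $V_h^{\pi,\nu}(x)$ and $Q_h^{\pi,\nu}(x,a,b)$ be the expected sum of the rewards of steps $h,\dots,H$ started from $x_h=x$, respectively from $(x_h,a_h,b_h)=(x,a,b)$; $V_h^*(x)=\sup_\pi\inf_\nu V_h^{\pi,\nu}(x)$ is the value of the game and $Q_h^*=\sup_\pi\inf_\nu Q_h^{\pi,\nu}$. For $f:\mathcal S\times\mathcal A\times\mathcal B\to\mathbb R$ write $f(x,\mu,\eta)=\mathbb E_{a\sim\mu,b\sim\eta}f(x,a,b)$, $\mathrm{val}f(x)=\max_{\mu\in\Delta(\mathcal A)}\min_{\eta\in\Delta(\mathcal B)}f(x,\mu,\eta)$, and $\mathcal T_hf(x,a,b)=r_h(x,a,b)+\mathbb E_{x'\sim\mathbb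 P_h(\cdot|x,a,b)}[\mathrm{val}f(x')]$. Let $\mathcal F=\mathcal F_1\times\dots\times\mathcal F_H$, where each $\mathcal F_h$ is a set of measurable functions $\mathcal S\times\mathcal A\times\mathcal B\to[-1,1]$, and put $f_{H+1}=0$ for $f\in\mathcal F$. Assume * realizability: $Q_h^*\in\mathcal F_h$ for all $h\in[H]$; * completeness: $\mathcal T_hf_{h+1}\in\mathcal F_h$ for all $f\in\mathcal F$ and $h\in[H]$. $\mathcal N(\mathcal F,\epsilon)$ is the least number of elements of $\mathcal F$ forming an $\epsilon$-cover of $\mathcal F$ in the metric $\max_h\|f_h-g_h\|_\infty$. For a class $\mathcal G$ of functions, a measure $\rho$ is $\epsilon$-independent of $\rho_1,\dots,\rho_n$ if some $g\in\mathcal G$ has $\big(\sum_i(\mathbb E_{\rho_i}g)^2\big)^{1/2}\le\epsilon$ and $|\mathbb E_\rho g|>\epsilon$; $\dim_{\mathrm{DE}}(\mathcal G,\mathcal D,\epsilon)$ is the largest length of a sequence in $\mathcal D$ such that, for some $\epsilon'\ge\epsilon$, every member is $\epsilon'$-independent of its predecessors. The Minimax Eluder dimension is $\dim_{\mathrm{ME}}(\mathcal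 F,\epsilon)=\max_{h\in[H]}\dim_{\mathrm{DE}}(\{f_h-\mathcal T_hf_{h+1}:f\in\mathcal F\},\mathcal D_\Delta,\epsilon)$, where $\mathcal D_\Delta$ is the set of Dirac measures on $\mathcal S\times\mathcal A\times\mathcal B$. **Algorithm (width $\beta$).** In episode $k=1,\dots,K$ an initial state $x_1^k$ is revealed (it may be fixed, or depend on the past). Player 1 forms the confidence set $\mathcal V^k$ of all $f\in\mathcal F$ such that, for all $h\in[H]$, $\mathcal L_h^k(f_h,f_{h+1})\le\inf_{g\in\mathcal F_h}\mathcal L_h^k(g,f_{h+1})+\beta$, where $$\mathcal L_h^k(g,f')=\sum_{i<k}\big(g(x_h^i,a_h^i,b_h^i)-r_h(x_h^i,a_h^i,b_h^i)-\mathrm{val}f'(x_{h+1}^i)\big)^2,$$ chooses $f^k\in\arg\max_{f\in\mathcal V^k}\mathrm{val}f_1(x_1^k)$ (measurably in the past), and plays a policy $\pi^k$ for which $\pi_h^k(x)$ is, for all $h$ and $x$, a max-min strategy of the matrix game $f_h^k(x,\cdot,\cdot)$. Player 2 plays an arbitrary policy $\nu^k$, chosen from the information available at the start of the episode, possibly with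 private randomness. The actions are drawn independently from $\pi_h^k(x_h^k)$ and $\nu_h^k(x_h^k)$, and $x_{h+1}^k\sim\mathbb P_h(\cdot\mid x_h^k,a_h^k,b_h^k)$. **Theorem.** There is an absolute constant $c_0>0$ such that for every $c\ge c_0$ there is a constant $C>0$, depending only on $c$, with the following property. Let $K\ge1$, $H\ge1$ and $p\in(0,1)$, where $p\le\frac12$ is required if $H=K=1$; suppose that $\mathcal N(\mathcal F,1/K)$ and $d_{\mathrm{ME}}=\dim_{\mathrm{ME}}(\mathcal F,\sqrt{1/K})$ are finite, and that player 1 runs the algorithm with $\beta=c\log\big(HK\,\mathcal N(\mathcal F,1/K)/p\big)$. Then, against every opponent, with probability at least $1-p$, $$\sum_{k=1}^K\big(V_1^*(x_1^k)-V_1^{\pi^k,\nu^k}(x_1^k)\big)\le C\,H\sqrt{K\,\max\{1,d_{\mathrm{ME}}\}\,\log\big(HK\,\mathcal N(\mathcal F,1/K)/p\big)}.$$ -/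

import Mathlib

open MeasureTheory ProbabilityTheory

universe u v w z

noncomputable section

/-- A two-player zero-sum episodic Markov game with simultaneous moves, state space `S`,
action sets `A` (player 1) and `B` (player 2), horizon `H`, deterministic rewards in `[-1, 1]` and
transition kernels. Steps are numbered `0, …, H - 1`; data with index `≥ H` is never used. -/
structure MarkovGame (S : Type u) (A : Type v) (B : Type w)
    [MeasurableSpace S] [MeasurableSpace A] [MeasurableSpace B] where
  H : ℕ
  reward : ℕ → S × A × B → ℝ
  measurable_reward : ∀ h, Measurable (reward h)
  reward_mem : ∀ h s, reward h s ∈ Set.Icc (-1 : ℝ) 1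
  kernel : ℕ → Kernel (S × A × B) S
  markov : ∀ h, IsMarkovKernel (kernel h)

/-- A stochastic (Markov) policy: at each step, a measurable map from states to the probability
simplex over the actions. -/
structure Policy (S : Type u) (A : Type v) [MeasurableSpace S] [Fintype A] where
  prob : ℕ → S → A → ℝ
  prob_mem : ∀ h x, prob h x ∈ stdSimplex ℝ A
  measurable_prob : ∀ h a, Measurable fun x => prob h x a

/-- The expected payoff `q(μ, ν) = E_{a ∼ μ, b ∼ ν} q(a, b)` in the matrix game `q`. -/
def mixedPayoff {A : Type v} {B : Type w} [Fintype A] [Fintype B]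
    (q : A → B → ℝ) (μ : A → ℝ) (ν : B → ℝ) : ℝ :=
  ∑ a, ∑ b, μ a * ν b * q a b

/-- What the mixed strategy `μ` of player 1 guarantees in the matrix game: `min_ν q(μ, ν)`. -/
def guarantee {A : Type v} {B : Type w} [Fintype A] [Fintype B]
    (q : A → B → ℝ) (μ : A → ℝ) : ℝ :=
  ⨅ ν : stdSimplex ℝ B, mixedPayoff q μ ν

/-- The value `max_μ min_ν q(μ, ν)` of the matrix game `q`. -/
def matrixValue {A : Type v} {B : Type w} [Fintype A] [Fintype B] (q : A → B → ℝ) : ℝ :=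
  ⨆ μ : stdSimplex ℝ A, guarantee q μ

/-- The matrix game `f(x, ·, ·)` at state `x`. -/
def atState {S : Type u} {A : Type v} {B : Type w} (f : S × A × B → ℝ) (x : S) : A → B → ℝ :=
  fun a b => f (x, a, b)

/-- `ρ` is `ε`-independent of the measures `prev` with respect to the function class `𝒢`. -/
def EpsIndependent {X : Type*} [MeasurableSpace X] (𝒢 : Set (X → ℝ)) (ε : ℝ) {n : ℕ}
    (prev : Fin n → Measure X) (ρ : Measure X) : Prop :=
  ∃ g ∈ 𝒢, Real.sqrt (∑ i, (∫ s, g s ∂(prev i)) ^ 2) ≤ ε ∧ ε < |∫ s, g s ∂ρ|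

/-- The distributional Eluder dimension `dim_DE(𝒢, D, ε)`: the supremum of the lengths of sequences
in `D` such that, for some `ε' ≥ ε`, each member is `ε'`-independent of its predecessors. -/
def distEluderDim {X : Type*} [MeasurableSpace X] (𝒢 : Set (X → ℝ)) (D : Set (Measure X))
    (ε : ℝ) : ℕ∞ :=
  ⨆ (n : ℕ) (_ : ∃ ρ : Fin n → Measure X, (∀ i, ρ i ∈ D) ∧ ∃ ε' : ℝ, ε ≤ ε' ∧
    ∀ i : Fin n, EpsIndependent 𝒢 ε' (fun j : Fin i => ρ (Fin.castLE i.isLt.le j)) (ρ i)), (n : ℕ∞)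

namespace MarkovGame

variable {S : Type u} {A : Type v} {B : Type w}
  [MeasurableSpace S] [MeasurableSpace A] [MeasurableSpace B] [Fintype A] [Fintype B]

/-- Expected total reward of the steps `h, …, h + n - 1` when the state at step `h` is `x` and the
players follow `π` and `ν`, computed by conditioning on the first step. -/
def expectedReward (G : MarkovGame S A B) (π : Policy S A) (ν : Policy S B) : ℕ → ℕ → S → ℝ
  | 0, _, _ => 0
  | n + 1, h, x => mixedPayoff
      (fun a b => G.reward h (x, a, b) +
        ∫ y, expectedReward G π ν n (h + 1) y ∂(G.kernel h (x, a, b)))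
      (π.prob h x) (ν.prob h x)

/-- The value function `V_h^{π,ν}`. -/
def V (G : MarkovGame S A B) (π : Policy S A) (ν : Policy S B) (h : ℕ) (x : S) : ℝ :=
  G.expectedReward π ν (G.H - h) h x

/-- The action-value function `Q_h^{π,ν}`, for `h < H`. -/
def Q (G : MarkovGame S A B) (π : Policy S A) (ν : Policy S B) (h : ℕ) (s : S × A × B) : ℝ :=
  G.reward h s + ∫ y, G.V π ν (h + 1) y ∂(G.kernel h s)

/-- The value `V_h^*` of the game. -/
def Vstar (G : MarkovGame S A B) (h : ℕ) (x : S) : ℝ :=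
  ⨆ π : Policy S A, ⨅ ν : Policy S B, G.V π ν h x

/-- The action-value function `Q_h^*` of the game. -/
def Qstar (G : MarkovGame S A B) (h : ℕ) (s : S × A × B) : ℝ :=
  ⨆ π : Policy S A, ⨅ ν : Policy S B, G.Q π ν h s

/-- The minimax Bellman operator `𝒯_h`. -/
def bellman (G : MarkovGame S A B) (h : ℕ) (f : S × A × B → ℝ) (s : S × A × B) : ℝ :=
  G.reward h s + ∫ y, matrixValue (atState f y) ∂(G.kernel h s)

/-- The product class `F_0 × ⋯ × F_{H-1}`, its members being extended by `f_h = 0` for `h ≥ H`. -/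
def valueClass (G : MarkovGame S A B) (F : ℕ → Set (S × A × B → ℝ)) :
    Set (ℕ → S × A × B → ℝ) :=
  {f | (∀ h < G.H, f h ∈ F h) ∧ ∀ h, G.H ≤ h → f h = 0}

/-- Members of the class are measurable with values in `[-1, 1]`. -/
def IsNormalized (G : MarkovGame S A B) (F : ℕ → Set (S × A × B → ℝ)) : Prop :=
  ∀ h < G.H, ∀ g ∈ F h, Measurable g ∧ ∀ s, g s ∈ Set.Icc (-1 : ℝ) 1

/-- Realizability: `Q_h^* ∈ F_h` for every step `h`. -/
def Realizable (G : MarkovGame S A B) (F : ℕ → Set (S × A × B → ℝ)) : Prop :=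
  ∀ h < G.H, G.Qstar h ∈ F h

/-- Completeness: `𝒯_h f_{h+1} ∈ F_h` for every step `h` and every `f` in the class
(with `f_H = 0`). -/
def Complete (G : MarkovGame S A B) (F : ℕ → Set (S × A × B → ℝ)) : Prop :=
  ∀ f ∈ G.valueClass F, ∀ h < G.H, G.bellman h (f (h + 1)) ∈ F h

/-- The `ε`-covering number of the class in the metric `max_h ‖f_h - g_h‖_∞`. -/
def coveringNumber (G : MarkovGame S A B) (F : ℕ → Set (S × A × B → ℝ)) (ε : ℝ) : ℕ∞ :=
  ⨅ (t : Finset (ℕ → S × A × B → ℝ)) (_ : ↑t ⊆ G.valueClass F ∧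
    ∀ f ∈ G.valueClass F, ∃ g ∈ t, ∀ h < G.H, ∀ s, |f h s - g h s| ≤ ε), (t.card : ℕ∞)

/-- The class `(I - 𝒯_h) F` of Bellman residuals. -/
def residuals (G : MarkovGame S A B) (F : ℕ → Set (S × A × B → ℝ)) (h : ℕ) :
    Set (S × A × B → ℝ) :=
  {g | ∃ f ∈ G.valueClass F, g = fun s => f h s - G.bellman h (f (h + 1)) s}

/-- The Minimax Eluder dimension: the maximum over the steps of the distributional Eluder dimension
of the Bellman residuals with respect to the Dirac measures. -/
def minimaxEluderDim (G : MarkovGame S A B) (F : ℕ → Set (S × A × B → ℝ)) (ε : ℝ) : ℕ∞ :=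
  ⨆ (h : ℕ) (_ : h < G.H),
    distEluderDim (G.residuals F h) (Set.range (Measure.dirac : S × A × B → Measure (S × A × B))) ε

/-- The squared Bellman loss of `g` at step `h` against the target built from `f'` (a candidate for
step `h + 1`) on the data of the episodes `0, …, k - 1`; `x i h`, `a i h`, `b i h` are the state and
the actions at step `h` of episode `i`. -/
def loss (G : MarkovGame S A B) (x : ℕ → ℕ → S) (a : ℕ → ℕ → A) (b : ℕ → ℕ → B)
    (k h : ℕ) (g f' : S × A × B → ℝ) : ℝ :=
  ∑ i ∈ Finset.range k, (g (x i h, a i h, b i h) - G.reward h (x i h, a i h, b i h)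
    - matrixValue (atState f' (x i (h + 1)))) ^ 2

/-- The confidence set of episode `k`: all `f` in the class with
`loss (f_h, f_{h+1}) ≤ inf_{g ∈ F_h} loss (g, f_{h+1}) + β` at every step `h`. -/
def confidenceSet (G : MarkovGame S A B) (F : ℕ → Set (S × A × B → ℝ)) (β : ℝ)
    (x : ℕ → ℕ → S) (a : ℕ → ℕ → A) (b : ℕ → ℕ → B) (k : ℕ) : Set (ℕ → S × A × B → ℝ) :=
  {f | f ∈ G.valueClass F ∧ ∀ h < G.H, ∀ g ∈ F h,
    G.loss x a b k h (f h) (f (h + 1)) ≤ G.loss x a b k h g (f (h + 1)) + β}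

/-- `K` episodes in which player 1 runs the confidence-set algorithm with global optimism and
width `β` against an arbitrary opponent.

`x k h`, `a k h`, `b k h` are the state and the actions at step `h` of episode `k`; `π k`, `ν k` are
the policies of the players in episode `k`; `f k` is the optimistic function chosen by the
algorithm; `𝓗 k h` is the information available when the state of step `h` in episode `k` has been
observed (it may contain private randomness of the players). Both policies are fixed at the start of
the episode, on the basis of `𝓗 k 0`. -/
structure IsRun (G : MarkovGame S A B) (F : ℕ → Set (S × A × B → ℝ)) (β : ℝ) (K : ℕ)
    {Ω : Type z} [MeasurableSpace Ω] (P : Measure Ω) (𝓗 : ℕ → ℕ → MeasurableSpace Ω)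
    (x : ℕ → ℕ → Ω → S) (a : ℕ → ℕ → Ω → A) (b : ℕ → ℕ → Ω → B)
    (f : ℕ → Ω → ℕ → S × A × B → ℝ) (π : ℕ → Ω → Policy S A) (ν : ℕ → Ω → Policy S B) : Prop where
  /-- The information grows with time. -/
  le_space : ∀ k < K, ∀ h ≤ G.H, 𝓗 k h ≤ ‹MeasurableSpace Ω›
  mono_step : ∀ k < K, ∀ h < G.H, 𝓗 k h ≤ 𝓗 k (h + 1)
  mono_episode : ∀ k, k + 1 < K → 𝓗 k G.H ≤ 𝓗 (k + 1) 0
  measurable_state : ∀ k < K, ∀ h ≤ G.H, Measurable[𝓗 k h] (x k h)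
  measurable_action₁ : ∀ k < K, ∀ h < G.H, Measurable[𝓗 k (h + 1)] (a k h)
  measurable_action₂ : ∀ k < K, ∀ h < G.H, Measurable[𝓗 k (h + 1)] (b k h)
  /-- The algorithm's choices and the opponent's policy depend measurably on the information at the
  start of the episode. -/
  measurable_f : ∀ k < K, ∀ h < G.H, ∀ i j,
    Measurable[(𝓗 k 0).prod ‹MeasurableSpace S›] fun q : Ω × S => f k q.1 h (q.2, i, j)
  measurable_π : ∀ k < K, ∀ h < G.H, ∀ i,
    Measurable[(𝓗 k 0).prod ‹MeasurableSpace S›] fun q : Ω × S => (π k q.1).prob h q.2 i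
  measurable_ν : ∀ k < K, ∀ h < G.H, ∀ j,
    Measurable[(𝓗 k 0).prod ‹MeasurableSpace S›] fun q : Ω × S => (ν k q.1).prob h q.2 j
  /-- Given the past, the two actions are drawn independently from the policies of the players, and
  then the next state is drawn from the transition kernel. -/
  law : ∀ k < K, ∀ h < G.H, ∀ i j, ∀ E : Set S, MeasurableSet E →
    P[{ω | a k h ω = i ∧ b k h ω = j ∧ x k (h + 1) ω ∈ E}.indicator (fun _ => (1 : ℝ)) | 𝓗 k h]
      =ᵐ[P] fun ω => (π k ω).prob h (x k h ω) i * (ν k ω).prob h (x k h ω) j *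
        (G.kernel h (x k h ω, i, j)).real E
  /-- `f k` lies in the confidence set built from the earlier episodes. -/
  mem_confidenceSet : ∀ k < K, ∀ ω, f k ω ∈ G.confidenceSet F β
    (fun i h => x i h ω) (fun i h => a i h ω) (fun i h => b i h ω) k
  /-- `f k` maximizes the matrix-game value at the initial state over the confidence set. -/
  optimistic : ∀ k < K, ∀ ω, ∀ g ∈ G.confidenceSet F β
    (fun i h => x i h ω) (fun i h => a i h ω) (fun i h => b i h ω) k,
    matrixValue (atState (g 0) (x k 0 ω)) ≤ matrixValue (atState (f k ω 0) (x k 0 ω))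
  /-- Player 1 plays, at every state, a max-min strategy of the matrix game given by `f k`. -/
  maximin : ∀ k < K, ∀ ω, ∀ h < G.H, ∀ y,
    guarantee (atState (f k ω h) y) ((π k ω).prob h y) = matrixValue (atState (f k ω h) y)

/-- The regret over `K` episodes with initial states `x₁ k`, against the value of the game. -/
def regret (G : MarkovGame S A B) (K : ℕ) (x₁ : ℕ → S) (π : ℕ → Policy S A) (ν : ℕ → Policy S B) :
    ℝ :=
  ∑ k ∈ Finset.range K, (G.Vstar 0 (x₁ k) - G.V (π k) (ν k) 0 (x₁ k))

end MarkovGame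

end

/-! Optimism turns regret into Bellman residuals, and the Eluder dimension bounds the residuals.

On a good event the optimal action values lie in every confidence set, so the value of the game at
the initial state is at most the value predicted by `f k`. Player 1 plays max-min strategies for `f
k`, so the predicted value is at most its payoff against whatever the opponent plays. Unrolling this
over the steps bounds predicted minus actual value by the expected sum of the residuals `f_h - 𝒯_h
f_{h+1}` (`matrixValue_sub_le_expectedSum_residual`). Only max-min values occur, so no minimax
theorem is needed. An Azuma–Hoeffding bound over episodes replaces expected sums by sums along the
realized trajectories.

The good event comes from an exponential supermartingale. For a fixed pair `(u, v)`, the excess loss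
of `u` over `𝒯_h v` on one data point has conditional mean `(u - 𝒯_h v)²` and noise that is
sub-Gaussian of scale proportional to `|u - 𝒯_h v|`. Hoeffding's lemma thus absorbs the noise into
half of the mean (`integral_exp_regressionGap_le`), and with high probability half the squared
distance is at most the excess loss plus `4ℓ`. A union bound over a `1/K`-cover, the steps and the
episodes makes this uniform. With `v` the optimal action values it gives optimism; with `v` the next
component of `u`, together with completeness, it shows that the residual of `f k` has a sum of
squares of order `β` on the data before episode `k`.

Finally, functions that fit all earlier data but are larger than `α` at the current point can be
sorted into about `R / α²` sequences of `α`-independent points, each no longer than the dimension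
`d` (`sq_mul_card_le_of_distEluderDim_le`). So the `t`-th largest residual is of order `√(dR/t)`, up
to `√(1/K)` and up to `d` exceptions, and summing gives `√(dRK)` per step. -/

theorem measurable_uncurried_pi {X A B : Type*} [MeasurableSpace X] {q : X → A → B → ℝ}
    (hq : ∀ a b, Measurable fun x => q x a b) : Measurable q :=
  measurable_pi_lambda _ fun a => measurable_pi_lambda _ fun b => hq a b

/-! ### Matrix games: stability of the value, and measurable choice of strategies. -/

section MatrixGames

variable {A : Type v} {B : Type w} [Fintype A] [Fintype B]

theorem mixedPayoff_add (q q' : A → B → ℝ) (μ : A → ℝ) (ν : B → ℝ) :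
    mixedPayoff (fun a b => q a b + q' a b) μ ν = mixedPayoff q μ ν + mixedPayoff q' μ ν := by
  simp only [mixedPayoff, mul_add, Finset.sum_add_distrib]

theorem mixedPayoff_sub (q q' : A → B → ℝ) (μ : A → ℝ) (ν : B → ℝ) :
    mixedPayoff (fun a b => q a b - q' a b) μ ν = mixedPayoff q μ ν - mixedPayoff q' μ ν := by
  simp only [mixedPayoff, mul_sub, Finset.sum_sub_distrib]

theorem mixedPayoff_const_mul (c : ℝ) (q : A → B → ℝ) (μ : A → ℝ) (ν : B → ℝ) :
    mixedPayoff (fun a b => c * q a b) μ ν = c * mixedPayoff q μ ν := by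
  simp only [mixedPayoff, Finset.mul_sum]
  exact Finset.sum_congr rfl fun a _ => Finset.sum_congr rfl fun b _ => by ring

theorem mixedPayoff_const (c : ℝ) {μ : A → ℝ} {ν : B → ℝ} (hμ : μ ∈ stdSimplex ℝ A)
    (hν : ν ∈ stdSimplex ℝ B) : mixedPayoff (fun _ _ => c) μ ν = c := by
  have : mixedPayoff (fun _ _ => c) μ ν = (∑ a, μ a) * (∑ b, ν b) * c := by
    rw [Finset.sum_mul_sum, Finset.sum_mul]
    simp only [mixedPayoff, Finset.sum_mul]
  rw [this, hμ.2, hν.2]; ring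

theorem mixedPayoff_mono {q q' : A → B → ℝ} {μ : A → ℝ} {ν : B → ℝ} (hμ : μ ∈ stdSimplex ℝ A)
    (hν : ν ∈ stdSimplex ℝ B) (h : ∀ a b, q a b ≤ q' a b) :
    mixedPayoff q μ ν ≤ mixedPayoff q' μ ν :=
  Finset.sum_le_sum fun a _ => Finset.sum_le_sum fun b _ =>
    mul_le_mul_of_nonneg_left (h a b) (mul_nonneg (hμ.1 a) (hν.1 b))

theorem abs_mixedPayoff_le {q : A → B → ℝ} {M : ℝ} {μ : A → ℝ} {ν : B → ℝ}
    (hμ : μ ∈ stdSimplex ℝ A) (hν : ν ∈ stdSimplex ℝ B) (h : ∀ a b, |q a b| ≤ M) :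
    |mixedPayoff q μ ν| ≤ M := by
  rw [abs_le]
  constructor
  · rw [← mixedPayoff_const (-M) hμ hν]
    exact mixedPayoff_mono hμ hν fun a b => (abs_le.1 (h a b)).1
  · rw [← mixedPayoff_const M hμ hν]
    exact mixedPayoff_mono hμ hν fun a b => (abs_le.1 (h a b)).2

theorem exists_abs_le_of_fintype (q : A → B → ℝ) : ∃ M, ∀ a b, |q a b| ≤ M := by
  refine ⟨∑ a, ∑ b, |q a b|, fun a b => ?_⟩
  calc |q a b| ≤ ∑ b, |q a b| :=
        Finset.single_le_sum (f := fun b => |q a b|) (fun _ _ => abs_nonneg _) (Finset.mem_univ b)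
    _ ≤ _ := Finset.single_le_sum (f := fun a => ∑ b, |q a b|)
        (fun _ _ => Finset.sum_nonneg fun _ _ => abs_nonneg _) (Finset.mem_univ a)

theorem stdSimplex_nonempty [Nonempty A] : Nonempty (stdSimplex ℝ A) := by
  classical
  exact ⟨⟨Pi.single (Classical.arbitrary A) 1, single_mem_stdSimplex ℝ _⟩⟩

theorem guarantee_le (q : A → B → ℝ) {μ : A → ℝ} (hμ : μ ∈ stdSimplex ℝ A) {ν : B → ℝ}
    (hν : ν ∈ stdSimplex ℝ B) : guarantee q μ ≤ mixedPayoff q μ ν := by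
  obtain ⟨M, hM⟩ := exists_abs_le_of_fintype q
  refine ciInf_le (f := fun ν : stdSimplex ℝ B => mixedPayoff q μ ν) ?_ ⟨ν, hν⟩
  refine ⟨-M, ?_⟩
  rintro _ ⟨ν, rfl⟩
  exact (abs_le.1 (abs_mixedPayoff_le hμ ν.2 hM)).1

theorem le_guarantee [Nonempty B] {q : A → B → ℝ} {μ : A → ℝ} {c : ℝ}
    (h : ∀ ν ∈ stdSimplex ℝ B, c ≤ mixedPayoff q μ ν) : c ≤ guarantee q μ := by
  have := stdSimplex_nonempty (A := B)
  exact le_ciInf fun ν => h ν ν.2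

theorem guarantee_le_matrixValue [Nonempty B] (q : A → B → ℝ) {μ : A → ℝ}
    (hμ : μ ∈ stdSimplex ℝ A) : guarantee q μ ≤ matrixValue q := by
  obtain ⟨M, hM⟩ := exists_abs_le_of_fintype q
  obtain ⟨ν₀⟩ := stdSimplex_nonempty (A := B)
  refine le_ciSup (f := fun μ : stdSimplex ℝ A => guarantee q μ) ?_ ⟨μ, hμ⟩
  refine ⟨M, ?_⟩
  rintro _ ⟨μ, rfl⟩
  exact (guarantee_le q μ.2 ν₀.2).trans (abs_le.1 (abs_mixedPayoff_le μ.2 ν₀.2 hM)).2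

theorem matrixValue_le [Nonempty A] {q : A → B → ℝ} {c : ℝ}
    (h : ∀ μ ∈ stdSimplex ℝ A, guarantee q μ ≤ c) : matrixValue q ≤ c := by
  have := stdSimplex_nonempty (A := A)
  exact ciSup_le fun μ => h μ μ.2

theorem guarantee_le_add [Nonempty B] {q q' : A → B → ℝ} {μ μ' : A → ℝ} {ε : ℝ}
    (hμ : μ ∈ stdSimplex ℝ A)
    (h : ∀ ν ∈ stdSimplex ℝ B, mixedPayoff q μ ν ≤ mixedPayoff q' μ' ν + ε) :
    guarantee q μ ≤ guarantee q' μ' + ε := by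
  rw [← sub_le_iff_le_add]
  exact le_guarantee fun ν hν => by linarith [guarantee_le q hμ hν, h ν hν]

theorem mixedPayoff_le_add {q q' : A → B → ℝ} {ε : ℝ} (h : ∀ a b, |q a b - q' a b| ≤ ε)
    {μ : A → ℝ} (hμ : μ ∈ stdSimplex ℝ A) {ν : B → ℝ} (hν : ν ∈ stdSimplex ℝ B) :
    mixedPayoff q μ ν ≤ mixedPayoff q' μ ν + ε := by
  have := (abs_le.1 (abs_mixedPayoff_le hμ hν h)).2
  rw [mixedPayoff_sub] at this
  linarith

theorem matrixValue_le_add [Nonempty A] [Nonempty B] {q q' : A → B → ℝ} {ε : ℝ}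
    (h : ∀ a b, |q a b - q' a b| ≤ ε) : matrixValue q ≤ matrixValue q' + ε :=
  matrixValue_le fun _ hμ => (guarantee_le_add hμ fun _ hν => mixedPayoff_le_add h hμ hν).trans
    (by linarith [guarantee_le_matrixValue q' hμ])

theorem abs_matrixValue_sub_le [Nonempty A] [Nonempty B] {q q' : A → B → ℝ} {ε : ℝ}
    (h : ∀ a b, |q a b - q' a b| ≤ ε) : |matrixValue q - matrixValue q'| ≤ ε := by
  have h₁ := matrixValue_le_add h
  have h₂ := matrixValue_le_add (q := q') (q' := q) fun a b => by
    rw [abs_sub_comm]; exact h a b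
  rw [abs_le]; constructor <;> linarith

theorem matrixValue_zero [Nonempty A] [Nonempty B] :
    matrixValue (fun (_ : A) (_ : B) => (0 : ℝ)) = 0 := by
  obtain ⟨μ⟩ := stdSimplex_nonempty (A := A)
  obtain ⟨ν⟩ := stdSimplex_nonempty (A := B)
  refine le_antisymm (matrixValue_le fun μ hμ => ?_) ?_
  · exact (guarantee_le _ hμ ν.2).trans_eq (mixedPayoff_const 0 hμ ν.2)
  · exact (le_guarantee fun ν hν => (mixedPayoff_const 0 μ.2 hν).ge).trans
      (guarantee_le_matrixValue _ μ.2)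

theorem abs_matrixValue_le [Nonempty A] [Nonempty B] {q : A → B → ℝ} {M : ℝ}
    (h : ∀ a b, |q a b| ≤ M) : |matrixValue q| ≤ M := by
  simpa [matrixValue_zero] using
    abs_matrixValue_sub_le (q := q) (q' := fun _ _ => 0) (ε := M) (by simpa using h)

theorem continuous_matrixValue [Nonempty A] [Nonempty B] :
    Continuous (matrixValue : (A → B → ℝ) → ℝ) := by
  refine (LipschitzWith.of_dist_le_mul (K := 1) fun q q' => ?_).continuous
  rw [NNReal.coe_one, one_mul, Real.dist_eq]
  refine abs_matrixValue_sub_le fun a b => ?_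
  rw [← Real.dist_eq]
  exact (dist_le_pi_dist (q a) (q' a) b).trans (dist_le_pi_dist q q' a)

theorem continuous_guarantee [Nonempty B] {μ : A → ℝ} (hμ : μ ∈ stdSimplex ℝ A) :
    Continuous fun q : A → B → ℝ => guarantee q μ := by
  refine (LipschitzWith.of_dist_le_mul (K := 1) fun q q' => ?_).continuous
  have key : ∀ q q' : A → B → ℝ, guarantee q μ ≤ guarantee q' μ + dist q q' := fun q q' =>
    guarantee_le_add hμ fun ν hν => mixedPayoff_le_add (fun a b => by
      rw [← Real.dist_eq]
      exact (dist_le_pi_dist (q a) (q' a) b).trans (dist_le_pi_dist q q' a)) hμ hν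
  rw [NNReal.coe_one, one_mul, Real.dist_eq, abs_le]
  constructor
  · linarith [key q' q, dist_comm q q']
  · linarith [key q q']

/-- Continuity in the strategy lets a countable dense family of strategies contain one that is
max-min up to `ε`; measurable selection then reduces to taking the first such index. -/
theorem continuous_guarantee_strategy [Nonempty B] (q : A → B → ℝ) :
    Continuous fun μ : stdSimplex ℝ A => guarantee q μ := by
  obtain ⟨M, hM⟩ := exists_abs_le_of_fintype q
  have key : ∀ μ μ' : stdSimplex ℝ A,
      guarantee q μ ≤ guarantee q μ' + ∑ a, |μ a - μ' a| * M := by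
    intro μ μ'
    refine guarantee_le_add μ.2 fun ν hν => ?_
    rw [← sub_le_iff_le_add', mixedPayoff, mixedPayoff, ← Finset.sum_sub_distrib]
    refine Finset.sum_le_sum fun a _ => ?_
    have : ∑ b, μ a * ν b * q a b - ∑ b, μ' a * ν b * q a b
        = (μ a - μ' a) * ∑ b, ν b * q a b := by
      rw [Finset.mul_sum, ← Finset.sum_sub_distrib]
      exact Finset.sum_congr rfl fun b _ => by ring
    rw [this]
    refine (le_abs_self _).trans ?_
    rw [abs_mul]
    refine mul_le_mul_of_nonneg_left ?_ (abs_nonneg _)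
    calc |∑ b, ν b * q a b| ≤ ∑ b, |ν b * q a b| := Finset.abs_sum_le_sum_abs _ _
      _ ≤ ∑ b, ν b * M := Finset.sum_le_sum fun b _ => by
          rw [abs_mul, abs_of_nonneg (hν.1 b)]
          exact mul_le_mul_of_nonneg_left (hM a b) (hν.1 b)
      _ = M := by rw [← Finset.sum_mul, hν.2, one_mul]
  have hc : ∀ a, Continuous fun μ : stdSimplex ℝ A => μ a := fun a =>
    (continuous_apply a).comp continuous_subtype_val
  refine continuous_iff_continuousAt.2 fun μ₀ => ?_
  have hlim : Filter.Tendsto (fun μ : stdSimplex ℝ A => ∑ a, |μ a - μ₀ a| * M) (nhds μ₀)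
      (nhds 0) := by
    have : Continuous fun μ : stdSimplex ℝ A => ∑ a, |μ a - μ₀ a| * M :=
      continuous_finsetSum _ fun a _ => (((hc a).sub continuous_const).abs).mul continuous_const
    simpa using this.tendsto μ₀
  rw [ContinuousAt, tendsto_iff_dist_tendsto_zero]
  refine squeeze_zero (fun _ => dist_nonneg) (fun μ => ?_) hlim
  rw [Real.dist_eq, abs_le]
  constructor
  · have := key μ₀ μ
    simp only [abs_sub_comm (μ₀ _)] at this
    linarith
  · linarith [key μ μ₀]

theorem continuous_mixedPayoff_right (q : A → B → ℝ) (μ : A → ℝ) :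
    Continuous fun ν : stdSimplex ℝ B => mixedPayoff q μ ν := by
  have hc : ∀ b, Continuous fun ν : stdSimplex ℝ B => ν b := fun b =>
    (continuous_apply b).comp continuous_subtype_val
  exact continuous_finsetSum _ fun a _ => continuous_finsetSum _ fun b _ =>
    (continuous_const.mul (hc b)).mul continuous_const

section Measurable

variable {X : Type*} [MeasurableSpace X]

theorem measurable_mixedPayoff {q : X → A → B → ℝ} (hq : ∀ a b, Measurable fun x => q x a b)
    {μ : X → A → ℝ} (hμ : ∀ a, Measurable fun x => μ x a) {ν : X → B → ℝ}
    (hν : ∀ b, Measurable fun x => ν x b) : Measurable fun x => mixedPayoff (q x) (μ x) (ν x) := by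
  unfold mixedPayoff
  exact Finset.measurable_sum _ fun a _ => Finset.measurable_sum _ fun b _ =>
    ((hμ a).mul (hν b)).mul (hq a b)

theorem measurable_matrixValue [Nonempty A] [Nonempty B] {q : X → A → B → ℝ}
    (hq : ∀ a b, Measurable fun x => q x a b) : Measurable fun x => matrixValue (q x) :=
  continuous_matrixValue.measurable.comp (measurable_uncurried_pi hq)

/-- A measurable choice of strategies that are max-min up to `ε`. -/
theorem exists_measurable_maximin [Nonempty A] [Nonempty B] {q : X → A → B → ℝ}
    (hq : ∀ a b, Measurable fun x => q x a b) {ε : ℝ} (hε : 0 < ε) :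
    ∃ μ : X → A → ℝ, (∀ x, μ x ∈ stdSimplex ℝ A) ∧ (∀ a, Measurable fun x => μ x a) ∧
      ∀ x, ∀ ν ∈ stdSimplex ℝ B, matrixValue (q x) - ε ≤ mixedPayoff (q x) (μ x) ν := by
  classical
  have := stdSimplex_nonempty (A := A)
  obtain ⟨μs, hμs⟩ := TopologicalSpace.exists_dense_seq (stdSimplex ℝ A)
  let p : ℕ → X → Prop := fun n x => matrixValue (q x) - ε < guarantee (q x) (μs n)
  have hp : ∀ n, MeasurableSet {x | p n x} := fun n =>
    measurableSet_lt ((measurable_matrixValue hq).sub_const ε)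
      ((continuous_guarantee (μs n).2).measurable.comp (measurable_uncurried_pi hq))
  -- Strict inequality makes the set of good strategies open, so the dense sequence meets it.
  have hex : ∀ x, ∃ n, p n x := by
    intro x
    obtain ⟨μ, hμ⟩ : ∃ μ : stdSimplex ℝ A, matrixValue (q x) - ε < guarantee (q x) μ :=
      exists_lt_of_lt_ciSup (sub_lt_self _ hε)
    exact hμs.exists_mem_open
      (isOpen_lt continuous_const (continuous_guarantee_strategy (q x))) ⟨μ, hμ⟩
  refine ⟨fun x => μs (Nat.find (hex x)), fun x => (μs _).2, fun a => ?_, fun x ν hν => ?_⟩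
  · exact Measurable.find (f := fun n _ => μs n a) (fun n => measurable_const) hp hex
  · exact (Nat.find_spec (hex x)).le.trans (guarantee_le _ (μs _).2 hν)

/-- A measurable choice of best responses up to `ε`. -/
theorem exists_measurable_bestResponse [Nonempty A] [Nonempty B] {q : X → A → B → ℝ}
    (hq : ∀ a b, Measurable fun x => q x a b) {μ : X → A → ℝ} (hμ : ∀ x, μ x ∈ stdSimplex ℝ A)
    (hμm : ∀ a, Measurable fun x => μ x a) {ε : ℝ} (hε : 0 < ε) :
    ∃ ν : X → B → ℝ, (∀ x, ν x ∈ stdSimplex ℝ B) ∧ (∀ b, Measurable fun x => ν x b) ∧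
      ∀ x, mixedPayoff (q x) (μ x) (ν x) ≤ matrixValue (q x) + ε := by
  classical
  have := stdSimplex_nonempty (A := B)
  obtain ⟨νs, hνs⟩ := TopologicalSpace.exists_dense_seq (stdSimplex ℝ B)
  let p : ℕ → X → Prop := fun n x => mixedPayoff (q x) (μ x) (νs n) < matrixValue (q x) + ε
  have hp : ∀ n, MeasurableSet {x | p n x} := fun n =>
    measurableSet_lt (measurable_mixedPayoff hq hμm fun b => measurable_const)
      ((measurable_matrixValue hq).add_const ε)
  have hex : ∀ x, ∃ n, p n x := by
    intro x
    obtain ⟨ν, hν⟩ : ∃ ν : stdSimplex ℝ B, mixedPayoff (q x) (μ x) ν < matrixValue (q x) + ε :=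
      exists_lt_of_ciInf_lt ((guarantee_le_matrixValue (q x) (hμ x)).trans_lt
        (lt_add_of_pos_right _ hε))
    exact hνs.exists_mem_open
      (isOpen_lt (continuous_mixedPayoff_right (q x) (μ x)) continuous_const) ⟨ν, hν⟩
  refine ⟨fun x => νs (Nat.find (hex x)), fun x => (νs _).2, fun b => ?_, fun x => ?_⟩
  · exact Measurable.find (f := fun n _ => νs n b) (fun n => measurable_const) hp hex
  · exact (Nat.find_spec (hex x)).le

end Measurable

end MatrixGames

/-! ### Integrals of bounded functions. -/

section BoundedIntegrals

variable {Y : Type*} [MeasurableSpace Y] {μ : Measure Y}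

theorem integrable_of_abs_le [IsFiniteMeasure μ] {g : Y → ℝ} (hg : Measurable g) {M : ℝ}
    (h : ∀ y, |g y| ≤ M) : Integrable g μ :=
  Integrable.of_bound hg.aestronglyMeasurable M (Filter.Eventually.of_forall h)

theorem abs_integral_le_of_abs_le [IsProbabilityMeasure μ] {g : Y → ℝ} {M : ℝ}
    (h : ∀ y, |g y| ≤ M) : |∫ y, g y ∂μ| ≤ M := by
  have h' : ∀ᵐ y ∂μ, ‖g y‖ ≤ M := Filter.Eventually.of_forall h
  simpa using norm_integral_le_of_norm_le_const h'

end BoundedIntegrals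

/-! ### The value of the Markov game by backward induction. -/

namespace MarkovGame

variable {S : Type u} {A : Type v} {B : Type w}
  [MeasurableSpace S] [MeasurableSpace A] [MeasurableSpace B] [Fintype A] [Fintype B]

instance (G : MarkovGame S A B) (h : ℕ) : IsMarkovKernel (G.kernel h) := G.markov h

/-- Expected total of the step rewards `ρ` over the steps `h, …, h + n - 1` when the state at step
`h` is `x` and the players follow `π` and `ν`. -/
noncomputable def expectedSum (G : MarkovGame S A B) (ρ : ℕ → S × A × B → ℝ) (π : Policy S A)
    (ν : Policy S B) : ℕ → ℕ → S → ℝ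
  | 0, _, _ => 0
  | n + 1, h, x => mixedPayoff
      (fun a b => ρ h (x, a, b) +
        ∫ y, expectedSum G ρ π ν n (h + 1) y ∂(G.kernel h (x, a, b)))
      (π.prob h x) (ν.prob h x)

theorem expectedSum_reward (G : MarkovGame S A B) (π : Policy S A) (ν : Policy S B) (n : ℕ) :
    ∀ h, G.expectedSum G.reward π ν n h = G.expectedReward π ν n h := by
  induction n with
  | zero => intro h; rfl
  | succ n ih => intro h; funext x; simp only [expectedSum, expectedReward, ih]

theorem abs_expectedSum_le (G : MarkovGame S A B) {ρ : ℕ → S × A × B → ℝ} {M : ℝ}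
    (π : Policy S A) (ν : Policy S B) (n : ℕ) :
    ∀ h, (∀ i < h + n, ∀ s, |ρ i s| ≤ M) → ∀ x, |G.expectedSum ρ π ν n h x| ≤ n * M := by
  induction n with
  | zero => intro h _ x; simp [expectedSum]
  | succ n ih =>
    intro h hρ x
    refine abs_mixedPayoff_le (π.prob_mem h x) (ν.prob_mem h x) fun a b => ?_
    have h₁ := hρ h (by omega) (x, a, b)
    have h₂ := abs_integral_le_of_abs_le (μ := G.kernel h (x, a, b))
      (ih (h + 1) fun i hi => hρ i (by omega))
    refine (abs_add_le _ _).trans ?_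
    push_cast
    linarith

section Joint

variable {T : Type*} [MeasurableSpace T]

omit [Fintype A] [Fintype B] in
theorem measurable_integral_kernel [MeasurableSingletonClass A] [MeasurableSingletonClass B]
    (G : MarkovGame S A B) (h : ℕ) (a : A) (b : B) {g : T × S → ℝ} (hg : Measurable g) :
    Measurable fun q : T × S => ∫ y, g (q.1, y) ∂(G.kernel h (q.2, a, b)) := by
  have hc : Measurable fun q : T × S => (q.2, a, b) :=
    measurable_snd.prodMk (measurable_const.prodMk measurable_const)
  have hg' : StronglyMeasurable fun q : (T × S) × S => g (q.1.1, q.2) :=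
    (hg.comp ((measurable_fst.comp measurable_fst).prodMk measurable_snd)).stronglyMeasurable
  exact (StronglyMeasurable.integral_kernel_prod_right' (κ := (G.kernel h).comap _ hc)
    hg').measurable

/-- The parameter space `T` serves as `Ω` with the information at the start of an episode, where
policies and step rewards are random; `T = Unit` is the deterministic case. -/
theorem measurable_expectedSum [MeasurableSingletonClass A] [MeasurableSingletonClass B]
    (G : MarkovGame S A B) {ρ : T → ℕ → S × A × B → ℝ} {π : T → Policy S A} {ν : T → Policy S B}
    (n : ℕ) : ∀ h,
    (∀ i < h + n, ∀ a b, Measurable fun q : T × S => ρ q.1 i (q.2, a, b)) →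
    (∀ i < h + n, ∀ a, Measurable fun q : T × S => (π q.1).prob i q.2 a) →
    (∀ i < h + n, ∀ b, Measurable fun q : T × S => (ν q.1).prob i q.2 b) →
    Measurable fun q : T × S => G.expectedSum (ρ q.1) (π q.1) (ν q.1) n h q.2 := by
  induction n with
  | zero => intro h _ _ _; exact measurable_const
  | succ n ih =>
    intro h hρ hπ hν
    have := ih (h + 1) (fun i hi => hρ i (by omega)) (fun i hi => hπ i (by omega))
      fun i hi => hν i (by omega)
    exact measurable_mixedPayoff
      (fun a b => (hρ h (by omega) a b).add (G.measurable_integral_kernel h a b this))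
      (hπ h (by omega)) (hν h (by omega))

end Joint

variable [MeasurableSingletonClass A] [MeasurableSingletonClass B]

theorem measurable_expectedReward (G : MarkovGame S A B) (π : Policy S A) (ν : Policy S B)
    (n h : ℕ) : Measurable (G.expectedReward π ν n h) := by
  have hs : ∀ a b, Measurable fun q : Unit × S => (q.2, a, b) := fun (a : A) (b : B) =>
    measurable_snd.prodMk (measurable_const.prodMk measurable_const)
  have := G.measurable_expectedSum (T := Unit) (ρ := fun _ => G.reward) (π := fun _ => π)
    (ν := fun _ => ν) n h (fun i _ a b => (G.measurable_reward i).comp (hs a b))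
    (fun i _ a => (π.measurable_prob i a).comp measurable_snd)
    (fun i _ b => (ν.measurable_prob i b).comp measurable_snd)
  simp only [expectedSum_reward] at this
  exact this.comp (measurable_const.prodMk measurable_id : Measurable fun x : S => (Unit.unit, x))

omit [MeasurableSingletonClass A] [MeasurableSingletonClass B] in
theorem abs_expectedReward_le (G : MarkovGame S A B) (π : Policy S A) (ν : Policy S B)
    (n h : ℕ) (x : S) : |G.expectedReward π ν n h x| ≤ n := by
  rw [← expectedSum_reward]
  simpa using G.abs_expectedSum_le (ρ := G.reward) (M := 1) π ν n h
    (fun i _ s => abs_le.2 (G.reward_mem i s)) x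

/-- The matrix game `r_h + P_h W`, where `W` is the continuation value. -/
noncomputable def stageGame (G : MarkovGame S A B) (h : ℕ) (W : S → ℝ) (x : S) (a : A) (b : B) : ℝ :=
  G.reward h (x, a, b) + ∫ y, W y ∂(G.kernel h (x, a, b))

/-- The value of the game with `n` steps left, at step `h`, by backward induction. -/
noncomputable def optValue (G : MarkovGame S A B) : ℕ → ℕ → S → ℝ
  | 0, _, _ => 0
  | n + 1, h, x => matrixValue (G.stageGame h (optValue G n (h + 1)) x)

omit [Fintype A] [Fintype B] in
theorem measurable_stageGame (G : MarkovGame S A B) (h : ℕ) {W : S → ℝ} (hW : Measurable W)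
    (a : A) (b : B) : Measurable fun x => G.stageGame h W x a b := by
  have hc : Measurable fun x : S => (x, a, b) :=
    measurable_id.prodMk (measurable_const.prodMk measurable_const)
  have h₁ := G.measurable_integral_kernel (T := Unit) h a b (hW.comp measurable_snd)
  exact ((G.measurable_reward h).comp hc).add
    (h₁.comp (measurable_const.prodMk measurable_id : Measurable fun x : S => (Unit.unit, x)))

variable [Nonempty A] [Nonempty B]

theorem measurable_optValue (G : MarkovGame S A B) (n : ℕ) : ∀ h, Measurable (G.optValue n h) := by
  induction n with
  | zero => intro h; exact measurable_const
  | succ n ih => intro h; exact measurable_matrixValue (G.measurable_stageGame h (ih (h + 1)))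

omit [MeasurableSingletonClass A] [MeasurableSingletonClass B] in
theorem abs_optValue_le (G : MarkovGame S A B) (n : ℕ) : ∀ h x, |G.optValue n h x| ≤ n := by
  induction n with
  | zero => intro h x; simp [optValue]
  | succ n ih =>
    intro h x
    refine abs_matrixValue_le fun a b => (abs_add_le _ _).trans ?_
    have h₁ : |G.reward h (x, a, b)| ≤ 1 := abs_le.2 (G.reward_mem h _)
    have h₂ := abs_integral_le_of_abs_le (μ := G.kernel h (x, a, b)) (ih (h + 1))
    push_cast
    linarith

omit [Fintype A] [Fintype B] [MeasurableSingletonClass A] [MeasurableSingletonClass B]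
  [Nonempty A] [Nonempty B] in
theorem integral_le_add_of_le (G : MarkovGame S A B) (h : ℕ) (s : S × A × B) {W W' : S → ℝ}
    (hW : Measurable W) (hW' : Measurable W') {M M' c : ℝ} (hM : ∀ y, |W y| ≤ M)
    (hM' : ∀ y, |W' y| ≤ M') (hle : ∀ y, W y ≤ W' y + c) :
    ∫ y, W y ∂(G.kernel h s) ≤ ∫ y, W' y ∂(G.kernel h s) + c := by
  have h₁ : ∫ y, (W' y + c) ∂(G.kernel h s) = ∫ y, W' y ∂(G.kernel h s) + c := by
    rw [integral_add (integrable_of_abs_le hW' hM') (integrable_const c)]; simp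
  rw [← h₁]
  exact integral_mono (integrable_of_abs_le hW hM)
    ((integrable_of_abs_le hW' hM').add (integrable_const c)) hle

/-- At each step, play a strategy that is max-min up to `ε` for the stage game with optimal
continuation. Each remaining step costs one `ε`, and the same policy works from every state against
every opponent. -/
theorem exists_near_optimal_policy (G : MarkovGame S A B) {ε : ℝ} (hε : 0 < ε) :
    ∃ π : Policy S A, ∀ ν : Policy S B, ∀ n h, n + h = G.H → ∀ x,
      G.optValue n h x ≤ G.expectedReward π ν n h x + n * ε := by
  have hsel : ∀ h, ∃ μ : S → A → ℝ, (∀ x, μ x ∈ stdSimplex ℝ A) ∧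
      (∀ a, Measurable fun x => μ x a) ∧ ∀ x, ∀ η ∈ stdSimplex ℝ B,
        matrixValue (G.stageGame h (G.optValue (G.H - (h + 1)) (h + 1)) x) - ε ≤
          mixedPayoff (G.stageGame h (G.optValue (G.H - (h + 1)) (h + 1)) x) (μ x) η := fun h =>
    exists_measurable_maximin (G.measurable_stageGame h (G.measurable_optValue _ _)) hε
  choose μ hμ hμm hμo using hsel
  refine ⟨⟨μ, hμ, hμm⟩, fun ν n => ?_⟩
  induction n with
  | zero => intro h _ x; simp [optValue, expectedReward]
  | succ n ih =>
    intro h hn x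
    have hn' : G.H - (h + 1) = n := by omega
    have h₁ := hμo h x (ν.prob h x) (ν.prob_mem h x)
    rw [hn'] at h₁
    have h₂ : mixedPayoff (G.stageGame h (G.optValue n (h + 1)) x) (μ h x) (ν.prob h x) ≤
        mixedPayoff (fun a b => G.stageGame h (G.expectedReward ⟨μ, hμ, hμm⟩ ν n (h + 1)) x a b
          + n * ε) (μ h x) (ν.prob h x) := by
      refine mixedPayoff_mono (hμ h x) (ν.prob_mem h x) fun a b => ?_
      have := G.integral_le_add_of_le h (x, a, b) (G.measurable_optValue n (h + 1))
        (G.measurable_expectedReward ⟨μ, hμ, hμm⟩ ν n (h + 1)) (G.abs_optValue_le n (h + 1))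
        (G.abs_expectedReward_le _ ν n (h + 1)) (ih (h + 1) (by omega))
      simp only [stageGame]
      linarith
    rw [mixedPayoff_add, mixedPayoff_const _ (hμ h x) (ν.prob_mem h x)] at h₂
    have h₃ : G.expectedReward ⟨μ, hμ, hμm⟩ ν (n + 1) h x =
      mixedPayoff (G.stageGame h (G.expectedReward ⟨μ, hμ, hμm⟩ ν n (h + 1)) x) (μ h x)
        (ν.prob h x) := rfl
    rw [h₃, optValue]
    push_cast
    linarith

/-- The strategy of `π` at a state guarantees at most the value of the stage game, so some reply
nearly achieves that bound. The reply is chosen after `π`, matching the order of sup and inf. -/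
theorem exists_near_best_response (G : MarkovGame S A B) (π : Policy S A) {ε : ℝ} (hε : 0 < ε) :
    ∃ ν : Policy S B, ∀ n h, n + h = G.H → ∀ x,
      G.expectedReward π ν n h x ≤ G.optValue n h x + n * ε := by
  have hsel : ∀ h, ∃ ν : S → B → ℝ, (∀ x, ν x ∈ stdSimplex ℝ B) ∧
      (∀ b, Measurable fun x => ν x b) ∧ ∀ x,
        mixedPayoff (G.stageGame h (G.optValue (G.H - (h + 1)) (h + 1)) x) (π.prob h x) (ν x) ≤
          matrixValue (G.stageGame h (G.optValue (G.H - (h + 1)) (h + 1)) x) + ε := fun h =>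
    exists_measurable_bestResponse (G.measurable_stageGame h (G.measurable_optValue _ _))
      (π.prob_mem h) (π.measurable_prob h) hε
  choose ν hν hνm hνo using hsel
  refine ⟨⟨ν, hν, hνm⟩, fun n => ?_⟩
  induction n with
  | zero => intro h _ x; simp [optValue, expectedReward]
  | succ n ih =>
    intro h hn x
    have hn' : G.H - (h + 1) = n := by omega
    have h₁ := hνo h x
    rw [hn'] at h₁
    have h₂ : mixedPayoff (G.stageGame h (G.expectedReward π ⟨ν, hν, hνm⟩ n (h + 1)) x)
        (π.prob h x) (ν h x) ≤
        mixedPayoff (fun a b => G.stageGame h (G.optValue n (h + 1)) x a b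
          + n * ε) (π.prob h x) (ν h x) := by
      refine mixedPayoff_mono (π.prob_mem h x) (hν h x) fun a b => ?_
      have := G.integral_le_add_of_le h (x, a, b)
        (G.measurable_expectedReward π ⟨ν, hν, hνm⟩ n (h + 1)) (G.measurable_optValue n (h + 1))
        (G.abs_expectedReward_le π _ n (h + 1)) (G.abs_optValue_le n (h + 1))
        (ih (h + 1) (by omega))
      simp only [stageGame]
      linarith
    rw [mixedPayoff_add, mixedPayoff_const _ (π.prob_mem h x) (hν h x)] at h₂
    have h₃ : G.expectedReward π ⟨ν, hν, hνm⟩ (n + 1) h x =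
      mixedPayoff (G.stageGame h (G.expectedReward π ⟨ν, hν, hνm⟩ n (h + 1)) x) (π.prob h x)
        (ν h x) := rfl
    rw [h₃, optValue]
    push_cast
    linarith

omit [MeasurableSpace A] [MeasurableSpace B] [Fintype B] [MeasurableSingletonClass A]
  [MeasurableSingletonClass B] [Nonempty B] in
theorem nonempty_policy : Nonempty (Policy S A) := by
  obtain ⟨μ⟩ := stdSimplex_nonempty (A := A)
  exact ⟨⟨fun _ _ => μ, fun _ _ => μ.2, fun _ _ => measurable_const⟩⟩

/-- If `c` is both achieved and unimprovable up to arbitrarily small errors, it is the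
sup-inf of `v`. -/
theorem iSup_iInf_eq_of_forall_pos {ι κ : Type*} [Nonempty ι] [Nonempty κ] {v : ι → κ → ℝ}
    {M c : ℝ} (hM : ∀ i j, |v i j| ≤ M) (hlow : ∀ ε > 0, ∃ i, ∀ j, c ≤ v i j + ε)
    (hupp : ∀ ε > 0, ∀ i, ∃ j, v i j ≤ c + ε) : ⨆ i, ⨅ j, v i j = c := by
  have hbelow : ∀ i, BddBelow (Set.range (v i)) := fun i =>
    ⟨-M, by rintro _ ⟨j, rfl⟩; exact (abs_le.1 (hM i j)).1⟩
  have hle : ∀ i, ⨅ j, v i j ≤ c := fun i => le_of_forall_pos_le_add fun ε hε => by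
    obtain ⟨j, hj⟩ := hupp ε hε i
    exact (ciInf_le (hbelow i) j).trans hj
  refine le_antisymm (ciSup_le hle) (le_of_forall_pos_le_add fun ε hε => ?_)
  obtain ⟨i, hi⟩ := hlow ε hε
  have h₁ : c - ε ≤ ⨅ j, v i j := le_ciInf fun j => by linarith [hi j]
  have h₂ : ⨅ j, v i j ≤ ⨆ i, ⨅ j, v i j :=
    le_ciSup (f := fun i => ⨅ j, v i j) ⟨c, by rintro _ ⟨i, rfl⟩; exact hle i⟩ i
  linarith

theorem Vstar_eq_optValue (G : MarkovGame S A B) {h : ℕ} (hh : h ≤ G.H) (x : S) :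
    G.Vstar h x = G.optValue (G.H - h) h x := by
  have := nonempty_policy (S := S) (A := A)
  have := nonempty_policy (S := S) (A := B)
  -- Accuracy `ε / (n + 1)` per step keeps the accumulated error below `ε`; the extra `1` covers the
  -- case of no remaining steps.
  have hn : (0 : ℝ) < (G.H - h : ℕ) + 1 := by positivity
  have hdiv : ∀ ε : ℝ, 0 < ε → (G.H - h : ℕ) * (ε / ((G.H - h : ℕ) + 1)) ≤ ε := fun ε hε => by
    rw [mul_div_left_comm]
    exact mul_le_of_le_one_right hε.le ((div_le_one hn).2 (by linarith))
  refine iSup_iInf_eq_of_forall_pos (fun π ν => G.abs_expectedReward_le π ν _ h x)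
    (fun ε hε => ?_) fun ε hε π => ?_
  · obtain ⟨π, hπ⟩ := G.exists_near_optimal_policy (div_pos hε hn)
    exact ⟨π, fun ν => (hπ ν (G.H - h) h (by omega) x).trans
      (add_le_add_right (hdiv ε hε) _)⟩
  · obtain ⟨ν, hν⟩ := G.exists_near_best_response π (div_pos hε hn)
    exact ⟨ν, (hν (G.H - h) h (by omega) x).trans (add_le_add_right (hdiv ε hε) _)⟩

theorem Qstar_eq_stageGame (G : MarkovGame S A B) {h : ℕ} (hh : h < G.H) (x : S) (a : A) (b : B) :
    G.Qstar h (x, a, b) = G.stageGame h (G.optValue (G.H - (h + 1)) (h + 1)) x a b := by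
  have := nonempty_policy (S := S) (A := A)
  have := nonempty_policy (S := S) (A := B)
  set n := G.H - (h + 1) with hn_def
  have hn : (0 : ℝ) < (n : ℝ) + 1 := by positivity
  have hdiv : ∀ ε : ℝ, 0 < ε → n * (ε / (n + 1)) ≤ ε := fun ε hε => by
    rw [mul_div_left_comm]
    exact mul_le_of_le_one_right hε.le ((div_le_one hn).2 (by linarith))
  refine iSup_iInf_eq_of_forall_pos (M := 1 + n) (fun π ν => ?_) (fun ε hε => ?_) fun ε hε π => ?_
  · refine (abs_add_le _ _).trans (add_le_add (abs_le.2 (G.reward_mem h _)) ?_)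
    exact abs_integral_le_of_abs_le fun y => G.abs_expectedReward_le π ν _ _ y
  · obtain ⟨π, hπ⟩ := G.exists_near_optimal_policy (div_pos hε hn)
    refine ⟨π, fun ν => ?_⟩
    have := G.integral_le_add_of_le h (x, a, b) (G.measurable_optValue n (h + 1))
      (G.measurable_expectedReward π ν n (h + 1)) (G.abs_optValue_le n (h + 1))
      (G.abs_expectedReward_le π ν n (h + 1)) (hπ ν n (h + 1) (by omega))
    have := hdiv ε hε
    simp only [stageGame, Q, V]
    linarith
  · obtain ⟨ν, hν⟩ := G.exists_near_best_response π (div_pos hε hn)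
    refine ⟨ν, ?_⟩
    have := G.integral_le_add_of_le h (x, a, b) (G.measurable_expectedReward π ν n (h + 1))
      (G.measurable_optValue n (h + 1)) (G.abs_expectedReward_le π ν n (h + 1))
      (G.abs_optValue_le n (h + 1)) (hν n (h + 1) (by omega))
    have := hdiv ε hε
    simp only [stageGame, Q, V]
    linarith

/-- The optimal action-value functions, extended by `0` beyond the horizon. -/
noncomputable def optimalQ (G : MarkovGame S A B) (h : ℕ) : S × A × B → ℝ :=
  if h < G.H then G.Qstar h else 0

omit [MeasurableSingletonClass A] [MeasurableSingletonClass B] [Nonempty A] [Nonempty B] in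
theorem Realizable.optimalQ_mem {G : MarkovGame S A B} {F : ℕ → Set (S × A × B → ℝ)}
    (hF : G.Realizable F) : G.optimalQ ∈ G.valueClass F := by
  refine ⟨fun h hh => ?_, fun h hh => ?_⟩
  · rw [optimalQ, if_pos hh]; exact hF h hh
  · rw [optimalQ, if_neg (not_lt.2 hh)]

theorem matrixValue_optimalQ (G : MarkovGame S A B) {h : ℕ} (hh : h ≤ G.H) (x : S) :
    matrixValue (atState (G.optimalQ h) x) = G.optValue (G.H - h) h x := by
  rcases hh.lt_or_eq with hlt | rfl
  · have : G.H - h = G.H - (h + 1) + 1 := by omega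
    rw [this, optValue]
    congr 1
    funext a b
    rw [atState, optimalQ, if_pos hlt, G.Qstar_eq_stageGame hlt]
  · rw [Nat.sub_self, optValue, optimalQ, if_neg (lt_irrefl _)]
    exact matrixValue_zero

theorem Vstar_eq_matrixValue_optimalQ (G : MarkovGame S A B) (x : S) :
    G.Vstar 0 x = matrixValue (atState (G.optimalQ 0) x) := by
  rw [G.Vstar_eq_optValue (Nat.zero_le _), G.matrixValue_optimalQ (Nat.zero_le _)]

/-- Identifies `optimalQ h` as the regression function when the target is built from `optimalQ (h +
1)`; this is what puts it into the confidence sets. -/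
theorem bellman_optimalQ (G : MarkovGame S A B) {h : ℕ} (hh : h < G.H) :
    G.bellman h (G.optimalQ (h + 1)) = G.optimalQ h := by
  funext ⟨x, a, b⟩
  rw [optimalQ.eq_def G h, if_pos hh, G.Qstar_eq_stageGame hh, bellman, stageGame]
  simp only [G.matrixValue_optimalQ (Nat.succ_le_of_lt hh)]

end MarkovGame

/-! ### The Eluder dimension and the pigeonhole bound. -/

section EluderDimension

variable {X : Type*} [MeasurableSpace X]

/-- A finite set of times at which the points `s k` are `ε'`-independent of the earlier ones has at
most `distEluderDim` elements. -/
theorem card_le_of_distEluderDim_le {𝒢 : Set (X → ℝ)} (h𝒢 : ∀ g ∈ 𝒢, Measurable g) {ε ε' : ℝ}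
    (hε : ε ≤ ε') {d : ℕ} (hd : distEluderDim 𝒢 (Set.range Measure.dirac) ε ≤ d) (s : ℕ → X)
    (J : Finset ℕ)
    (hJ : ∀ k ∈ J, ∃ g ∈ 𝒢, √(∑ i ∈ J.filter (· < k), g (s i) ^ 2) ≤ ε' ∧ ε' < |g (s k)|) :
    J.card ≤ d := by
  have key : ((J.card : ℕ) : ℕ∞) ≤ distEluderDim 𝒢 (Set.range Measure.dirac) ε := by
    refine le_iSup₂_of_le (f := fun (n : ℕ) (_ : ∃ ρ : Fin n → Measure X,
      (∀ i, ρ i ∈ Set.range Measure.dirac) ∧ ∃ ε' : ℝ, ε ≤ ε' ∧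
      ∀ i : Fin n, EpsIndependent 𝒢 ε' (fun j : Fin i => ρ (Fin.castLE i.isLt.le j)) (ρ i)) =>
        (n : ℕ∞)) J.card ?_ le_rfl
    refine ⟨fun i => Measure.dirac (s (J.orderEmbOfFin rfl i)), fun i => ⟨_, rfl⟩, ε', hε,
      fun i => ?_⟩
    obtain ⟨g, hg, hsum, hlt⟩ := hJ _ (J.orderEmbOfFin_mem rfl i)
    -- Points of `X` need not be measurable sets, hence the measurability assumption on the class.
    have hdir : ∀ x, ∫ y, g y ∂(Measure.dirac x) = g x := fun x =>
      integral_dirac' g x (h𝒢 g hg).stronglyMeasurable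
    refine ⟨g, hg, (Real.sqrt_le_sqrt ?_).trans hsum, by rwa [hdir]⟩
    simp only [hdir]
    let e : Fin i → ℕ := fun j => J.orderEmbOfFin rfl (Fin.castLE i.isLt.le j)
    have he : Function.Injective e := fun j j' hjj => by
      have := (J.orderEmbOfFin rfl).injective hjj
      exact Fin.castLE_injective _ this
    calc ∑ j : Fin i, g (s (e j)) ^ 2
        = ∑ k ∈ Finset.univ.image e, g (s k) ^ 2 :=
          (Finset.sum_image (f := fun k => g (s k) ^ 2) he.injOn).symm
      _ ≤ ∑ k ∈ J.filter (· < J.orderEmbOfFin rfl i), g (s k) ^ 2 := by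
          refine Finset.sum_le_sum_of_subset_of_nonneg ?_ fun _ _ _ => sq_nonneg _
          intro k hk
          obtain ⟨j, -, rfl⟩ := Finset.mem_image.1 hk
          refine Finset.mem_filter.2 ⟨J.orderEmbOfFin_mem rfl _, ?_⟩
          exact (J.orderEmbOfFin rfl).strictMono (Fin.lt_def.2 j.isLt)
  exact_mod_cast key.trans hd

omit [MeasurableSpace X] in
/-- Distribution of the times in `I` over `L` buckets, each time being independent of the earlier
times in its own bucket. -/
theorem exists_independent_coloring {𝒢 : Set (X → ℝ)} (s : ℕ → X) (φ : ℕ → X → ℝ) {α R : ℝ}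
    (hα : 0 < α) {L : ℕ} (hL : R < L * α ^ 2) (I : Finset ℕ) (hmem : ∀ k ∈ I, φ k ∈ 𝒢)
    (hlarge : ∀ k ∈ I, α < |φ k (s k)|)
    (hR : ∀ k ∈ I, ∑ i ∈ Finset.range k, φ k (s i) ^ 2 ≤ R) (n : ℕ) :
    ∃ col : ℕ → ℕ, ∀ k ∈ I, k < n → col k < L ∧ ∃ g ∈ 𝒢,
      √(∑ i ∈ (I.filter (· < k)).filter (col · = col k), g (s i) ^ 2) ≤ α ∧ α < |g (s k)| := by
  induction n with
  | zero => exact ⟨fun _ => 0, by simp⟩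
  | succ n ih =>
    obtain ⟨col, hcol⟩ := ih
    by_cases hn : n ∈ I
    swap
    · exact ⟨col, fun k hk hkn => hcol k hk
        (lt_of_le_of_ne (Nat.lt_succ_iff.1 hkn) fun h => hn (h ▸ hk))⟩
    -- If every bucket made time `n` dependent, each would carry more than `α²` of the sum of
    -- squares of `φ n`, exceeding the total budget `R < L α²`.
    obtain ⟨c, hcL, hc⟩ : ∃ c < L,
        √(∑ i ∈ (I.filter (· < n)).filter (col · = c), φ n (s i) ^ 2) ≤ α := by
      by_contra! hcon
      have h₁ : ∑ c ∈ Finset.range L,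
          ∑ i ∈ (I.filter (· < n)).filter (col · = c), φ n (s i) ^ 2 ≤ R := by
        rw [Finset.sum_fiberwise_of_maps_to fun i hi => Finset.mem_range.2
          (hcol i (Finset.mem_filter.1 hi).1 (Finset.mem_filter.1 hi).2).1]
        refine (Finset.sum_le_sum_of_subset_of_nonneg ?_ fun _ _ _ => sq_nonneg _).trans (hR n hn)
        exact fun i hi => Finset.mem_range.2 (Finset.mem_filter.1 hi).2
      have h₂ : ∑ _c ∈ Finset.range L, α ^ 2 ≤ ∑ c ∈ Finset.range L,
          ∑ i ∈ (I.filter (· < n)).filter (col · = c), φ n (s i) ^ 2 :=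
        Finset.sum_le_sum fun c hc =>
          ((Real.lt_sqrt hα.le).1 (hcon c (Finset.mem_range.1 hc))).le
      rw [Finset.sum_const, Finset.card_range, nsmul_eq_mul] at h₂
      linarith
    -- Recoloring `n` does not affect earlier times, whose conditions only look at their own past.
    refine ⟨Function.update col n c, fun k hk hkn => ?_⟩
    have hlt : ∀ i, i < k → Function.update col n c i = col i := fun i hi =>
      Function.update_of_ne (by omega) _ _
    rcases (Nat.lt_succ_iff.1 hkn).lt_or_eq with hkn' | rfl
    · have hk' : Function.update col n c k = col k := Function.update_of_ne (by omega) _ _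
      have hfil : (I.filter (· < k)).filter (Function.update col n c · = col k) =
          (I.filter (· < k)).filter (col · = col k) :=
        Finset.filter_congr fun i hi => by rw [hlt i (Finset.mem_filter.1 hi).2]
      rw [hk', hfil]
      exact hcol k hk hkn'
    · have hfil : (I.filter (· < k)).filter (Function.update col k c · = c) =
          (I.filter (· < k)).filter (col · = c) :=
        Finset.filter_congr fun i hi => by rw [hlt i (Finset.mem_filter.1 hi).2]
      rw [Function.update_self, hfil]
      exact ⟨hcL, φ k, hmem k hk, hc, hlarge k hk⟩

/-- Each of the `⌊R / α²⌋ + 1` buckets of the coloring is a sequence of `α`-independent points, so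
it has at most `d` members. -/
theorem sq_mul_card_le_of_distEluderDim_le {𝒢 : Set (X → ℝ)} (h𝒢 : ∀ g ∈ 𝒢, Measurable g)
    {ω α R : ℝ} (hα : 0 < α) (hωα : ω ≤ α) (hR0 : 0 ≤ R) {d : ℕ}
    (hd : distEluderDim 𝒢 (Set.range Measure.dirac) ω ≤ d) (s : ℕ → X) (φ : ℕ → X → ℝ)
    (I : Finset ℕ) (hmem : ∀ k ∈ I, φ k ∈ 𝒢) (hlarge : ∀ k ∈ I, α < |φ k (s k)|)
    (hR : ∀ k ∈ I, ∑ i ∈ Finset.range k, φ k (s i) ^ 2 ≤ R) :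
    α ^ 2 * I.card ≤ (R + α ^ 2) * d := by
  have hα2 : 0 < α ^ 2 := by positivity
  set L := ⌊R / α ^ 2⌋₊ + 1 with hL
  have hL₁ : R < L * α ^ 2 := by
    rw [← div_lt_iff₀ hα2, hL]; push_cast; exact Nat.lt_floor_add_one _
  have hL₂ : L * α ^ 2 ≤ R + α ^ 2 := by
    have : (⌊R / α ^ 2⌋₊ : ℝ) * α ^ 2 ≤ R := by
      rw [← le_div_iff₀ hα2]; exact Nat.floor_le (by positivity)
    rw [hL]; push_cast; linarith
  obtain ⟨col, hcol⟩ := exists_independent_coloring s φ hα hL₁ I hmem hlarge hR (I.sup id + 1)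
  have hlt : ∀ k ∈ I, k < I.sup id + 1 := fun k hk =>
    Nat.lt_succ_iff.2 (Finset.le_sup (f := id) hk)
  have hcard : I.card ≤ d * (Finset.range L).card := by
    refine Finset.card_le_mul_card_image_of_maps_to
      (fun k hk => Finset.mem_range.2 (hcol k hk (hlt k hk)).1) d fun c _ => ?_
    refine card_le_of_distEluderDim_le h𝒢 hωα hd s _ fun k hk => ?_
    obtain ⟨hkI, rfl⟩ := Finset.mem_filter.1 hk
    obtain ⟨-, g, hg, h₁, h₂⟩ := hcol k hkI (hlt k hkI)
    refine ⟨g, hg, ?_, h₂⟩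
    rw [Finset.filter_filter] at h₁ ⊢
    simpa only [and_comm] using h₁
  rw [Finset.card_range] at hcard
  have hcard' : (I.card : ℝ) ≤ d * L := by exact_mod_cast hcard
  calc α ^ 2 * I.card ≤ α ^ 2 * (d * L) := by gcongr
    _ = (L * α ^ 2) * d := by ring
    _ ≤ _ := by gcongr

/-- A substitute for sorting: the condition says that the `t`-th largest term, counted from zero, is
at most `c t`. Peeling off a small element of the remaining set avoids ordering the terms. -/
theorem sum_le_sum_of_forall_min_le {ι : Type*} (e : ι → ℝ) (c : ℕ → ℝ) (n : ℕ) :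
    ∀ I : Finset ι, I.card = n →
      (∀ J ⊆ I, J.Nonempty → ∃ k ∈ J, e k ≤ c (J.card - 1)) →
      ∑ k ∈ I, e k ≤ ∑ t ∈ Finset.range n, c t := by
  classical
  induction n with
  | zero => intro I hI _; rw [Finset.card_eq_zero] at hI; simp [hI]
  | succ n ih =>
    intro I hI h
    obtain ⟨k, hk, hek⟩ := h I subset_rfl (Finset.card_pos.1 (by omega))
    rw [← Finset.add_sum_erase I e hk, Finset.sum_range_succ, add_comm]
    rw [hI, Nat.add_sub_cancel] at hek
    refine add_le_add (ih _ (by rw [Finset.card_erase_of_mem hk, hI]; rfl) fun J hJ hJne => ?_) hek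
    exact h J (hJ.trans (Finset.erase_subset _ _)) hJne

theorem sum_inv_sqrt_shift_le (d n : ℕ) :
    ∑ t ∈ Finset.range n, (if t < d then 0 else 1 / √((t + 1 - d : ℕ) : ℝ)) ≤
      2 * √((n - d : ℕ) : ℝ) := by
  induction n with
  | zero => simp
  | succ n ih =>
    rw [Finset.sum_range_succ]
    split_ifs with h
    · have : n - d = n + 1 - d := by omega
      rw [← this]; linarith
    · have hm : n + 1 - d = (n - d) + 1 := by omega
      rw [hm]
      push_cast
      set m : ℝ := ((n - d : ℕ) : ℝ)
      have hm0 : 0 ≤ m := Nat.cast_nonneg _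
      have hb : 0 < √(m + 1) := Real.sqrt_pos.2 (by linarith)
      have h₁ : 1 / √(m + 1) ≤ 2 * √(m + 1) - 2 * √m := by
        rw [div_le_iff₀ hb]
        nlinarith [Real.sq_sqrt hm0, Real.sq_sqrt (by linarith : (0 : ℝ) ≤ m + 1),
          sq_nonneg (√(m + 1) - √m)]
      linarith

/-- Residuals that fit all earlier data are small at most of the times: the sum of their sizes at
the current points is bounded through the distributional Eluder dimension. -/
theorem sum_abs_le_of_distEluderDim_le {𝒢 : Set (X → ℝ)} (h𝒢 : ∀ g ∈ 𝒢, Measurable g)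
    {ω R M : ℝ} (hω : 0 < ω) (hR0 : 0 ≤ R) (hM : 0 ≤ M) {d : ℕ}
    (hd : distEluderDim 𝒢 (Set.range Measure.dirac) ω ≤ d) (s : ℕ → X) (φ : ℕ → X → ℝ) (K : ℕ)
    (hmem : ∀ k < K, φ k ∈ 𝒢) (hφM : ∀ k < K, |φ k (s k)| ≤ M)
    (hR : ∀ k < K, ∑ i ∈ Finset.range k, φ k (s i) ^ 2 ≤ R) :
    ∑ k ∈ Finset.range K, |φ k (s k)| ≤ M * √(K * d) + K * ω + 2 * √(d * R) * √K := by
  -- The `d` largest terms get the trivial bound `M`. Beyond them, `t + 1` terms above `α ≥ ω` force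
  -- `α² (t + 1 - d) ≤ d R`. The sum with `ω` ensures both `α ≥ ω` and strict violation of this
  -- inequality.
  let c : ℕ → ℝ := fun t => (if t < d then M else 0) + ω +
    √(d * R) * (if t < d then 0 else 1 / √((t + 1 - d : ℕ) : ℝ))
  have h₁ : ∑ k ∈ Finset.range K, |φ k (s k)| ≤ ∑ t ∈ Finset.range K, c t := by
    refine sum_le_sum_of_forall_min_le _ c K _ (Finset.card_range K) fun J hJ hJne => ?_
    have hJK : ∀ k ∈ J, k < K := fun k hk => Finset.mem_range.1 (hJ hk)
    by_cases hJd : J.card - 1 < d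
    · obtain ⟨k, hk⟩ := hJne
      refine ⟨k, hk, (hφM k (hJK k hk)).trans ?_⟩
      simp only [c, if_pos hJd]
      linarith
    · by_contra! hcon
      have hpos := hJne.card_pos
      have hm : J.card - 1 + 1 - d = J.card - d := by omega
      have hmpos : (0 : ℝ) < ((J.card - d : ℕ) : ℝ) := by
        exact_mod_cast (by omega : 0 < J.card - d)
      set m : ℝ := ((J.card - d : ℕ) : ℝ) with hm_def
      have hmeq : m = J.card - d := by rw [hm_def, Nat.cast_sub (by omega)]
      have hc : c (J.card - 1) = ω + √(d * R) * (1 / √m) := by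
        simp only [c, if_neg hJd, hm, zero_add]; rfl
      have hb : 0 ≤ √(d * R) * (1 / √m) := by positivity
      have hcount := sq_mul_card_le_of_distEluderDim_le h𝒢 (α := c (J.card - 1))
        (by rw [hc]; linarith) (by rw [hc]; linarith) hR0 hd s φ J
        (fun k hk => hmem k (hJK k hk)) hcon fun k hk => hR k (hJK k hk)
      have hsq : (√(d * R) * (1 / √m)) ^ 2 * m = d * R := by
        rw [mul_pow, div_pow, one_pow, Real.sq_sqrt (by positivity), Real.sq_sqrt hmpos.le]
        field_simp
      have hgt : (√(d * R) * (1 / √m)) ^ 2 < c (J.card - 1) ^ 2 := by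
        rw [hc]; exact pow_lt_pow_left₀ (by linarith) hb two_ne_zero
      have h₂ : c (J.card - 1) ^ 2 * m ≤ d * R := by rw [hmeq]; linarith
      nlinarith
  refine h₁.trans ?_
  simp only [c, Finset.sum_add_distrib, ← Finset.mul_sum]
  refine add_le_add (add_le_add ?_ ?_) ?_
  · rw [← Finset.sum_filter, Finset.sum_const, nsmul_eq_mul, mul_comm]
    refine mul_le_mul_of_nonneg_left (Real.le_sqrt_of_sq_le ?_) hM
    have hK : ((Finset.range K).filter (· < d)).card ≤ K := by
      simpa using Finset.card_filter_le (Finset.range K) (· < d)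
    have hd' : ((Finset.range K).filter (· < d)).card ≤ d := by
      calc _ ≤ (Finset.range d).card := Finset.card_le_card fun i hi =>
            Finset.mem_range.2 (Finset.mem_filter.1 hi).2
        _ = d := Finset.card_range d
    rw [sq]
    exact_mod_cast Nat.mul_le_mul hK hd'
  · simp
  · rw [mul_comm 2 (√(d * R)), mul_assoc]
    refine mul_le_mul_of_nonneg_left ((sum_inv_sqrt_shift_le d K).trans ?_) (Real.sqrt_nonneg _)
    gcongr
    exact_mod_cast Nat.sub_le K d

end EluderDimension

/-! ### From the conditional law of one step to integrals over the run. -/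

/-- If, given `Y`, the event `D` has probability `w Y` and on it `X` has law `κ Y`, then integrals
over `D` of functions of `(Y, X)` can be computed by averaging over `X` first. -/
theorem setIntegral_eq_of_conditional_law {Ω T S : Type*} {mΩ : MeasurableSpace Ω}
    {mT : MeasurableSpace T} {mS : MeasurableSpace S} {P : Measure Ω} [IsFiniteMeasure P]
    {Y : Ω → T} (hY : Measurable Y) {X : Ω → S} (hX : Measurable X) {D : Set Ω} {w : T → ℝ} (hw : Measurable w) (hw0 : ∀ t, 0 ≤ w t)
    (hw1 : ∀ t, w t ≤ 1) (κ : Kernel T S) [IsMarkovKernel κ]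
    (hlaw : ∀ F : Set T, MeasurableSet F → ∀ E : Set S, MeasurableSet E →
      P.real (Y ⁻¹' F ∩ (D ∩ X ⁻¹' E)) = ∫ ω in Y ⁻¹' F, w (Y ω) * (κ (Y ω)).real E ∂P)
    {Φ : T × S → ℝ} (hΦ : Measurable Φ) {M : ℝ} (hM : ∀ q, |Φ q| ≤ M) :
    ∫ ω in D, Φ (Y ω, X ω) ∂P = ∫ ω, w (Y ω) * ∫ y, Φ (Y ω, y) ∂(κ (Y ω)) ∂P := by
  have hYX : Measurable fun ω => (Y ω, X ω) := hY.prodMk hX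
  have hwf : ∀ t, ENNReal.ofReal (w t) ≠ ⊤ := fun _ => ENNReal.ofReal_ne_top
  set ρ : Measure T := (P.map Y).withDensity fun t => ENNReal.ofReal (w t) with hρ
  have : IsFiniteMeasure ρ := by
    refine isFiniteMeasure_withDensity_ofReal ?_
    exact (integrable_of_abs_le hw (M := 1)
      fun t => by rw [abs_of_nonneg (hw0 t)]; exact hw1 t).2
  -- The hypothesis is the equality of these two finite measures on rectangles, which determine
  -- them.
  have key : (P.restrict D).map (fun ω => (Y ω, X ω)) = ρ ⊗ₘ κ := by
    refine Measure.ext_prod fun {F E} hF hE => ?_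
    have hκE : Measurable fun t => κ t E := κ.measurable_coe hE
    rw [Measure.map_apply hYX (hF.prod hE), Measure.restrict_apply (hYX (hF.prod hE)),
      Measure.compProd_apply_prod hF hE, hρ,
      setLIntegral_withDensity_eq_setLIntegral_mul _ hw.ennreal_ofReal hκE hF,
      setLIntegral_map hF (hw.ennreal_ofReal.mul hκE) hY]
    have hset : (fun ω => (Y ω, X ω)) ⁻¹' F ×ˢ E ∩ D = Y ⁻¹' F ∩ (D ∩ X ⁻¹' E) := by
      ext ω; simp only [Set.mem_inter_iff, Set.mem_preimage, Set.mem_prod]; tauto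
    have hint : Measurable fun ω => w (Y ω) * (κ (Y ω)).real E :=
      (hw.comp hY).mul (hκE.ennreal_toReal.comp hY)
    have hnn : ∀ ω, 0 ≤ w (Y ω) * (κ (Y ω)).real E := fun ω =>
      mul_nonneg (hw0 _) measureReal_nonneg
    rw [hset, ← ENNReal.ofReal_toReal (measure_ne_top P _)]
    change ENNReal.ofReal (P.real _) = _
    rw [hlaw F hF E hE, ofReal_integral_eq_lintegral_ofReal
      (integrable_of_abs_le hint (M := 1) fun ω => ?_) (Filter.Eventually.of_forall hnn)]
    · refine lintegral_congr fun ω => ?_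
      rw [ENNReal.ofReal_mul (hw0 _), Pi.mul_apply, Measure.real,
        ENNReal.ofReal_toReal (measure_ne_top _ _)]
    · rw [abs_of_nonneg (hnn ω)]
      exact mul_le_one₀ (hw1 _) measureReal_nonneg measureReal_le_one
  have hm : Measurable fun t => ∫ y, Φ (t, y) ∂(κ t) :=
    (StronglyMeasurable.integral_kernel_prod_right' hΦ.stronglyMeasurable).measurable
  calc ∫ ω in D, Φ (Y ω, X ω) ∂P
      = ∫ q, Φ q ∂((P.restrict D).map fun ω => (Y ω, X ω)) :=
        (integral_map hYX.aemeasurable hΦ.aestronglyMeasurable).symm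
    _ = ∫ t, ∫ y, Φ (t, y) ∂(κ t) ∂ρ := by
        rw [key, Measure.integral_compProd (integrable_of_abs_le hΦ hM)]
    _ = ∫ t, w t * ∫ y, Φ (t, y) ∂(κ t) ∂(P.map Y) := by
        rw [hρ, integral_withDensity_eq_integral_toReal_smul hw.ennreal_ofReal
          (Filter.Eventually.of_forall fun t => (hwf t).lt_top)]
        refine integral_congr_ae (Filter.Eventually.of_forall fun t => ?_)
        simp only [smul_eq_mul, ENNReal.toReal_ofReal (hw0 t)]
    _ = _ := integral_map hY.aemeasurable (hw.mul hm).aestronglyMeasurable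

theorem measurable_comp_prodMk_of_le {Ω S Z : Type*} {m₀ m : MeasurableSpace Ω}
    [MeasurableSpace S] [MeasurableSpace Z] (hm : m₀ ≤ m) {F : Ω × S → Z}
    (hF : Measurable[m₀.prod ‹_›] F) {X : Ω → S} (hX : Measurable[m] X) :
    Measurable[m] fun ω => F (ω, X ω) :=
  @Measurable.comp Ω (Ω × S) Z m (m₀.prod ‹_›) _ F (fun ω => (ω, X ω)) hF
    ((measurable_id'' hm).prodMk hX)

theorem measurable_prod_of_le {Ω S Z : Type*} {m₀ m : MeasurableSpace Ω}
    [MeasurableSpace S] [MeasurableSpace Z] (hm : m₀ ≤ m) {F : Ω × S → Z}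
    (hF : Measurable[m₀.prod ‹_›] F) : Measurable[m.prod ‹_›] F :=
  hF.mono (sup_le_sup_right (MeasurableSpace.comap_mono hm) _) le_rfl

namespace MarkovGame

variable {S : Type u} {A : Type v} {B : Type w}
  [MeasurableSpace S] [MeasurableSpace A] [MeasurableSpace B] [Fintype A] [Fintype B]
  [MeasurableSingletonClass A] [MeasurableSingletonClass B]
  {G : MarkovGame S A B} {F : ℕ → Set (S × A × B → ℝ)} {β : ℝ} {K : ℕ}
  {Ω : Type z} [mΩ : MeasurableSpace Ω] {P : Measure Ω} [IsProbabilityMeasure P]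
  {𝓗 : ℕ → ℕ → MeasurableSpace Ω}
  {x : ℕ → ℕ → Ω → S} {a : ℕ → ℕ → Ω → A} {b : ℕ → ℕ → Ω → B}
  {f : ℕ → Ω → ℕ → S × A × B → ℝ} {π : ℕ → Ω → Policy S A} {ν : ℕ → Ω → Policy S B}

namespace IsRun

omit [MeasurableSingletonClass A] [MeasurableSingletonClass B] [IsProbabilityMeasure P] in
theorem le_of_le_step (hrun : G.IsRun F β K P 𝓗 x a b f π ν) {k : ℕ} (hk : k < K) {i j : ℕ}
    (hij : i ≤ j) (hj : j ≤ G.H) : 𝓗 k i ≤ 𝓗 k j := by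
  induction j, hij using Nat.le_induction with
  | base => exact le_rfl
  | succ n _ ih => exact (ih (by omega)).trans (hrun.mono_step k hk n (by omega))

/-- Averaging over the actions and the next state of one step. -/
theorem integral_step (hrun : G.IsRun F β K P 𝓗 x a b f π ν) {k h : ℕ} (hk : k < K) (hh : h < G.H)
    {Φ : A → B → Ω × S → ℝ}
    (hΦ : ∀ i j, Measurable[(𝓗 k h).prod ‹MeasurableSpace S›] (Φ i j)) {M : ℝ}
    (hM : ∀ i j q, |Φ i j q| ≤ M) :
    ∫ ω, Φ (a k h ω) (b k h ω) (ω, x k (h + 1) ω) ∂P =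
      ∫ ω, mixedPayoff (fun i j => ∫ y, Φ i j (ω, y) ∂(G.kernel h (x k h ω, i, j)))
        ((π k ω).prob h (x k h ω)) ((ν k ω).prob h (x k h ω)) ∂P := by
  classical
  have hle := hrun.le_space k hk h hh.le
  have hle' := hrun.le_space k hk (h + 1) hh
  have h0 : 𝓗 k 0 ≤ 𝓗 k h := hrun.le_of_le_step hk (Nat.zero_le _) hh.le
  have hx := hrun.measurable_state k hk h hh.le
  have hx' : Measurable (x k (h + 1)) := (hrun.measurable_state k hk (h + 1) hh).mono hle' le_rfl
  have ha : Measurable (a k h) := (hrun.measurable_action₁ k hk h hh).mono hle' le_rfl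
  have hb : Measurable (b k h) := (hrun.measurable_action₂ k hk h hh).mono hle' le_rfl
  let D : A → B → Set Ω := fun i j => {ω | a k h ω = i ∧ b k h ω = j}
  have hD : ∀ i j, MeasurableSet (D i j) := fun i j =>
    (ha (measurableSet_singleton i)).inter (hb (measurableSet_singleton j))
  have hπm : ∀ i, Measurable[𝓗 k h] fun ω => (π k ω).prob h (x k h ω) i := fun i =>
    measurable_comp_prodMk_of_le h0 (hrun.measurable_π k hk h hh i) hx
  have hνm : ∀ j, Measurable[𝓗 k h] fun ω => (ν k ω).prob h (x k h ω) j := fun j =>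
    measurable_comp_prodMk_of_le h0 (hrun.measurable_ν k hk h hh j) hx
  have hπ0 := fun ω i => ((π k ω).prob_mem h (x k h ω)).1 i
  have hν0 := fun ω j => ((ν k ω).prob_mem h (x k h ω)).1 j
  have hπ1 : ∀ ω i, (π k ω).prob h (x k h ω) i ≤ 1 := fun ω i => by
    rw [← ((π k ω).prob_mem h (x k h ω)).2]
    exact Finset.single_le_sum (fun i _ => hπ0 ω i) (Finset.mem_univ i)
  have hν1 : ∀ ω j, (ν k ω).prob h (x k h ω) j ≤ 1 := fun ω j => by
    rw [← ((ν k ω).prob_mem h (x k h ω)).2]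
    exact Finset.single_le_sum (fun j _ => hν0 ω j) (Finset.mem_univ j)
  have hxij : ∀ i j, Measurable[𝓗 k h] fun ω => (x k h ω, i, j) := fun i j =>
    hx.prodMk (@measurable_const (A × B) Ω _ (𝓗 k h) (i, j))
  have hΦΩ : ∀ i j, Measurable fun ω => Φ i j (ω, x k (h + 1) ω) := fun i j =>
    measurable_comp_prodMk_of_le hle (hΦ i j) hx'
  -- On each of the finitely many action cells, the past is encoded by the identity map from `Ω` to
  -- `Ω` with the σ-algebra `𝓗 k h`. This needs neither regular conditional distributions nor
  -- assumptions on `Ω`.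
  have hcell : ∀ i j, ∫ ω in D i j, Φ i j (ω, x k (h + 1) ω) ∂P =
      ∫ ω, (π k ω).prob h (x k h ω) i * (ν k ω).prob h (x k h ω) j *
        ∫ y, Φ i j (ω, y) ∂(G.kernel h (x k h ω, i, j)) ∂P := by
    intro i j
    let κ : @Kernel Ω S (𝓗 k h) _ := @Kernel.comap _ _ _ _ _ (𝓗 k h) (G.kernel h)
      (fun ω => (x k h ω, i, j)) (hxij i j)
    have hκ : @IsMarkovKernel _ _ (𝓗 k h) _ κ := by
      exact @Kernel.IsMarkovKernel.comap _ _ _ _ _ (𝓗 k h) _ _ _ (hxij i j)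
    refine @setIntegral_eq_of_conditional_law Ω Ω S mΩ (𝓗 k h) _ P _ id (measurable_id'' hle) _ hx'
      (D i j) (fun ω => (π k ω).prob h (x k h ω) i * (ν k ω).prob h (x k h ω) j)
      ((hπm i).mul (hνm j))
      (fun ω => mul_nonneg (hπ0 ω i) (hν0 ω j))
      (fun ω => mul_le_one₀ (hπ1 ω i) (hν0 ω j) (hν1 ω j)) κ hκ ?_ (Φ i j) (hΦ i j) M (hM i j)
    intro U hU E hE
    have hset : MeasurableSet {ω | a k h ω = i ∧ b k h ω = j ∧ x k (h + 1) ω ∈ E} := by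
      have : {ω | a k h ω = i ∧ b k h ω = j ∧ x k (h + 1) ω ∈ E} =
          D i j ∩ x k (h + 1) ⁻¹' E := by
        ext ω; simp only [D, Set.mem_inter_iff, Set.mem_ofPred_eq, Set.mem_preimage, and_assoc]
      rw [this]; exact (hD i j).inter (hx' hE)
    have h₁ := setIntegral_condExp hle (μ := P) (s := U) ((integrable_const (1 : ℝ)).indicator hset)
      hU
    have h₂ := integral_congr_ae (ae_restrict_of_ae (s := U) (hrun.law k hk h hh i j E hE))
    change _ = ∫ ω in U, Set.indicator _ (1 : Ω → ℝ) ω ∂P at h₁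
    rw [h₂, integral_indicator_one hset, measureReal_restrict_apply hset] at h₁
    have h₃ : ∀ ω, (κ ω).real E = (G.kernel h (x k h ω, i, j)).real E := fun ω => by
      rw [Kernel.comap_apply]
    simp only [Set.preimage_id, id, h₃]
    rw [h₁]
    congr 1
    ext ω
    simp only [D, Set.mem_inter_iff, Set.mem_ofPred_eq, Set.mem_preimage]
    tauto
  have hI : ∀ i j, Measurable fun ω => ∫ y, Φ i j (ω, y) ∂(G.kernel h (x k h ω, i, j)) :=
    fun i j => (measurable_comp_prodMk_of_le le_rfl
      (@measurable_integral_kernel S A B _ _ _ Ω (𝓗 k h) _ _ G h i j (Φ i j) (hΦ i j)) hx).mono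
      hle le_rfl
  have hI' : ∀ i j, Integrable (fun ω => (π k ω).prob h (x k h ω) i * (ν k ω).prob h (x k h ω) j *
      ∫ y, Φ i j (ω, y) ∂(G.kernel h (x k h ω, i, j))) P := fun i j => by
    refine integrable_of_abs_le (M := 1 * M) ((((hπm i).mul (hνm j)).mono hle le_rfl).mul
      (hI i j)) fun ω => ?_
    rw [abs_mul, abs_mul, abs_of_nonneg (hπ0 ω i), abs_of_nonneg (hν0 ω j)]
    exact mul_le_mul (mul_le_one₀ (hπ1 ω i) (hν0 ω j) (hν1 ω j))
      (abs_integral_le_of_abs_le fun y => hM i j _) (abs_nonneg _) zero_le_one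
  have hsplit : ∀ ω, Φ (a k h ω) (b k h ω) (ω, x k (h + 1) ω) =
      ∑ i, ∑ j, (D i j).indicator (fun ω => Φ i j (ω, x k (h + 1) ω)) ω := by
    intro ω
    rw [Finset.sum_eq_single (a k h ω), Finset.sum_eq_single (b k h ω)]
    · rw [Set.indicator_of_mem]; exact ⟨rfl, rfl⟩
    · intro j _ hj; rw [Set.indicator_of_notMem]; exact fun hm => hj hm.2.symm
    · simp
    · intro i _ hi
      exact Finset.sum_eq_zero fun j _ => Set.indicator_of_notMem (fun hm => hi hm.1.symm) _
    · simp
  have hInd : ∀ i j, Integrable ((D i j).indicator fun ω => Φ i j (ω, x k (h + 1) ω)) P :=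
    fun i j => (integrable_of_abs_le (hΦΩ i j) fun ω => hM i j _).indicator (hD i j)
  simp only [hsplit, mixedPayoff]
  rw [integral_finsetSum _ fun i _ => integrable_finsetSum _ fun j _ => hInd i j,
    integral_finsetSum _ fun i _ => integrable_finsetSum _ fun j _ => hI' i j]
  refine Finset.sum_congr rfl fun i _ => ?_
  rw [integral_finsetSum _ fun j _ => hInd i j, integral_finsetSum _ fun j _ => hI' i j]
  exact Finset.sum_congr rfl fun j _ => by rw [integral_indicator (hD i j), hcell]

end IsRun
end MarkovGame

/-! ### Exponential moments and the Azuma–Hoeffding inequality. -/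

/-- The chord of the exponential over `[-t, t]`. It is affine in `y`, so orthogonality to the
exponential of the past kills the second term; no conditional expectation is needed. -/
theorem exp_mul_le_cosh_add_mul_sinh {t y : ℝ} (hy : |y| ≤ 1) :
    Real.exp (t * y) ≤ Real.cosh t + y * Real.sinh t := by
  obtain ⟨h₁, h₂⟩ := abs_le.1 hy
  have := convexOn_exp.2 (Set.mem_univ (-t)) (Set.mem_univ t)
    (by linarith : (0 : ℝ) ≤ (1 - y) / 2) (by linarith : (0 : ℝ) ≤ (1 + y) / 2) (by ring)
  simp only [smul_eq_mul] at this
  rw [show (1 - y) / 2 * -t + (1 + y) / 2 * t = t * y by ring] at this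
  rw [Real.cosh_eq, Real.sinh_eq]
  linarith

theorem measure_lt_le_exp_neg {Ω : Type*} [MeasurableSpace Ω] {P : Measure Ω}
    [IsProbabilityMeasure P] {X : Ω → ℝ} (hX : Measurable X) {M : ℝ} (hM : ∀ ω, X ω ≤ M)
    {q : ℝ} (hq : ∫ ω, Real.exp (X ω) ∂P ≤ Real.exp q) (c : ℝ) :
    P {ω | c < X ω} ≤ ENNReal.ofReal (Real.exp (q - c)) := by
  have hint : Integrable (fun ω => Real.exp (X ω)) P :=
    integrable_of_abs_le hX.exp (M := Real.exp M) fun ω => by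
      rw [abs_of_pos (Real.exp_pos _)]; exact Real.exp_le_exp.2 (hM ω)
  have h₁ := mul_meas_ge_le_integral_of_nonneg
    (Filter.Eventually.of_forall fun ω => (Real.exp_pos (X ω)).le) hint (Real.exp c)
  have h₂ : P.real {ω | c < X ω} ≤ P.real {ω | Real.exp c ≤ Real.exp (X ω)} :=
    measureReal_mono fun ω hω => Real.exp_le_exp.2 (le_of_lt hω)
  rw [← ofReal_measureReal]
  refine ENNReal.ofReal_le_ofReal (h₂.trans ?_)
  rw [Real.exp_sub, le_div_iff₀ (Real.exp_pos c), mul_comm]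
  exact h₁.trans hq

/-- The Azuma–Hoeffding bound for the exponential moments of bounded increments, each orthogonal to
the exponential of the sum of the earlier ones. -/
theorem integral_exp_sum_le_of_orthogonal {Ω : Type*} [MeasurableSpace Ω] {P : Measure Ω}
    [IsProbabilityMeasure P] {Y : ℕ → Ω → ℝ} {c t : ℝ} (hc : 0 < c) (n : ℕ)
    (hY : ∀ k < n, Measurable (Y k)) (hYc : ∀ k < n, ∀ ω, |Y k ω| ≤ c)
    (hort : ∀ k < n, ∫ ω, Real.exp (t * ∑ j ∈ Finset.range k, Y j ω) * Y k ω ∂P = 0) :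
    ∫ ω, Real.exp (t * ∑ j ∈ Finset.range n, Y j ω) ∂P ≤ Real.exp (n * ((t * c) ^ 2 / 2)) := by
  induction n with
  | zero => simp
  | succ n ih =>
    have ih' := ih (fun k hk => hY k (by omega)) (fun k hk => hYc k (by omega))
      fun k hk => hort k (by omega)
    set Z : Ω → ℝ := fun ω => Real.exp (t * ∑ j ∈ Finset.range n, Y j ω) with hZ
    have hsum : Measurable fun ω => ∑ j ∈ Finset.range n, Y j ω :=
      Finset.measurable_sum _ fun j hj => hY j (by have := Finset.mem_range.1 hj; omega)
    have hZm : Measurable Z := (hsum.const_mul t).exp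
    have hZ0 : ∀ ω, 0 < Z ω := fun ω => Real.exp_pos _
    have hZb : ∀ ω, |Z ω| ≤ Real.exp (|t| * (n * c)) := fun ω => by
      rw [abs_of_pos (hZ0 ω)]
      refine Real.exp_le_exp.2 ((le_abs_self _).trans ?_)
      rw [abs_mul]
      refine mul_le_mul_of_nonneg_left ((Finset.abs_sum_le_sum_abs _ _).trans ?_) (abs_nonneg t)
      refine (Finset.sum_le_sum fun j hj => hYc j ?_ ω).trans_eq (by simp)
      have := Finset.mem_range.1 hj; omega
    have hYn := hY n (Nat.lt_succ_self n)
    have hZint := integrable_of_abs_le (μ := P) hZm hZb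
    have hZY : Integrable (fun ω => Z ω * Y n ω) P :=
      integrable_of_abs_le (M := Real.exp (|t| * (n * c)) * c) (hZm.mul hYn) fun ω => by
        rw [abs_mul]
        exact mul_le_mul (hZb ω) (hYc n (Nat.lt_succ_self n) ω) (abs_nonneg _) (Real.exp_pos _).le
    have hpt : ∀ ω, Real.exp (t * ∑ j ∈ Finset.range (n + 1), Y j ω) ≤
        Real.cosh (t * c) * Z ω + Real.sinh (t * c) / c * (Z ω * Y n ω) := by
      intro ω
      rw [Finset.sum_range_succ, mul_add, Real.exp_add]
      have h₁ : |Y n ω / c| ≤ 1 := by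
        rw [abs_div, abs_of_pos hc, div_le_one hc]; exact hYc n (Nat.lt_succ_self n) ω
      have h₂ := exp_mul_le_cosh_add_mul_sinh (t := t * c) h₁
      rw [show t * c * (Y n ω / c) = t * Y n ω by field_simp] at h₂
      calc Z ω * Real.exp (t * Y n ω)
          ≤ Z ω * (Real.cosh (t * c) + Y n ω / c * Real.sinh (t * c)) :=
            mul_le_mul_of_nonneg_left h₂ (hZ0 ω).le
        _ = _ := by ring
    have hort' : ∫ ω, Z ω * Y n ω ∂P = 0 := hort n (Nat.lt_succ_self n)
    calc ∫ ω, Real.exp (t * ∑ j ∈ Finset.range (n + 1), Y j ω) ∂P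
        ≤ ∫ ω, (Real.cosh (t * c) * Z ω + Real.sinh (t * c) / c * (Z ω * Y n ω)) ∂P :=
          integral_mono_of_nonneg (Filter.Eventually.of_forall fun ω => (Real.exp_pos _).le)
            ((hZint.const_mul _).add (hZY.const_mul _)) (Filter.Eventually.of_forall hpt)
      _ = Real.cosh (t * c) * ∫ ω, Z ω ∂P := by
          rw [integral_add (hZint.const_mul _) (hZY.const_mul _), integral_const_mul,
            integral_const_mul, hort', mul_zero, add_zero]
      _ ≤ Real.exp ((t * c) ^ 2 / 2) * Real.exp (n * ((t * c) ^ 2 / 2)) :=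
          mul_le_mul (Real.cosh_le_exp_half_sq _) ih'
            (integral_nonneg fun ω => (hZ0 ω).le) (Real.exp_pos _).le
      _ = _ := by rw [← Real.exp_add]; push_cast; ring_nf

theorem measure_sum_gt_le_of_orthogonal {Ω : Type*} [MeasurableSpace Ω] {P : Measure Ω}
    [IsProbabilityMeasure P] {Y : ℕ → Ω → ℝ} {c ℓ : ℝ} (hc : 0 < c) {n : ℕ} (hn : 0 < n)
    (hℓ : 0 ≤ ℓ) (hY : ∀ k < n, Measurable (Y k)) (hYc : ∀ k < n, ∀ ω, |Y k ω| ≤ c)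
    (hort : ∀ t : ℝ, ∀ k < n,
      ∫ ω, Real.exp (t * ∑ j ∈ Finset.range k, Y j ω) * Y k ω ∂P = 0) :
    P {ω | c * √(2 * n * ℓ) < ∑ k ∈ Finset.range n, Y k ω} ≤
      ENNReal.ofReal (Real.exp (-ℓ)) := by
  have hn' : (0 : ℝ) < n := Nat.cast_pos.2 hn
  rcases hℓ.eq_or_lt with rfl | hℓ
  · simpa using prob_le_one
  -- The optimal exponent: the moment bound becomes `exp ℓ` and the threshold times `t` becomes
  -- `2ℓ`.
  set t : ℝ := √(2 * ℓ / n) / c with ht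
  have htpos : 0 < t := div_pos (Real.sqrt_pos.2 (by positivity)) hc
  have htc : (t * c) ^ 2 = 2 * ℓ / n := by
    rw [ht, div_mul_cancel₀ _ hc.ne', Real.sq_sqrt (by positivity)]
  have hq := integral_exp_sum_le_of_orthogonal hc n hY hYc (hort t)
  have hmul : t * (c * √(2 * n * ℓ)) = 2 * ℓ := by
    rw [ht, ← mul_assoc, div_mul_cancel₀ _ hc.ne', ← Real.sqrt_mul (by positivity),
      show 2 * ℓ / n * (2 * n * ℓ) = (2 * ℓ) ^ 2 by field_simp]
    exact Real.sqrt_sq (by positivity)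
  have hX : Measurable fun ω => t * ∑ k ∈ Finset.range n, Y k ω :=
    (Finset.measurable_sum _ fun j hj => hY j (Finset.mem_range.1 hj)).const_mul t
  have hM : ∀ ω, t * ∑ k ∈ Finset.range n, Y k ω ≤ t * (n * c) := fun ω => by
    refine mul_le_mul_of_nonneg_left ?_ htpos.le
    refine (Finset.sum_le_sum fun j hj => (le_abs_self _).trans
      (hYc j (Finset.mem_range.1 hj) ω)).trans_eq (by simp)
  have := measure_lt_le_exp_neg hX hM hq (2 * ℓ)
  rw [htc, show (n : ℝ) * (2 * ℓ / n / 2) - 2 * ℓ = -ℓ by field_simp; ring] at this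
  refine (measure_mono fun ω hω => ?_).trans this
  rw [Set.mem_ofPred_eq] at hω ⊢
  rw [← hmul]
  exact mul_lt_mul_of_pos_left hω htpos

/-! ### Concentration of the squared Bellman loss for a fixed pair of functions. -/

namespace MarkovGame

variable {S : Type u} {A : Type v} {B : Type w}
  [MeasurableSpace S] [MeasurableSpace A] [MeasurableSpace B] [Fintype A] [Fintype B]
  [MeasurableSingletonClass A] [MeasurableSingletonClass B]

/-- The part of one data point in
`½ ∑ (u - 𝒯_h v)² - loss (u, v) + loss (𝒯_h v, v)`. -/
noncomputable def regressionGap (G : MarkovGame S A B) (h : ℕ) (u v : S × A × B → ℝ)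
    (s : S × A × B) (y : S) : ℝ :=
  (u s - G.bellman h v s) ^ 2 / 2 - (u s - G.reward h s - matrixValue (atState v y)) ^ 2 +
    (G.bellman h v s - G.reward h s - matrixValue (atState v y)) ^ 2

variable [Nonempty A] [Nonempty B]

omit [MeasurableSingletonClass A] [MeasurableSingletonClass B] in
theorem measurable_matrixValue_atState {v : S × A × B → ℝ} (hv : Measurable v) :
    Measurable fun y => matrixValue (atState v y) :=
  measurable_matrixValue fun a b =>
    hv.comp (measurable_id.prodMk (measurable_const (a := ((a, b) : A × B))))

omit [MeasurableSingletonClass A] [MeasurableSingletonClass B] in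
theorem measurable_bellman (G : MarkovGame S A B) (h : ℕ) {v : S × A × B → ℝ}
    (hv : Measurable v) : Measurable (G.bellman h v) := by
  have h₁ : StronglyMeasurable fun q : (S × A × B) × S => matrixValue (atState v q.2) :=
    ((measurable_matrixValue_atState hv).comp measurable_snd).stronglyMeasurable
  exact (G.measurable_reward h).add
    (StronglyMeasurable.integral_kernel_prod_right' (κ := G.kernel h) h₁).measurable

omit [MeasurableSingletonClass A] [MeasurableSingletonClass B] [MeasurableSpace S]
  [MeasurableSpace A] [MeasurableSpace B] in
theorem abs_matrixValue_atState_le {v : S × A × B → ℝ} {M : ℝ} (hv : ∀ s, |v s| ≤ M) (y : S) :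
    |matrixValue (atState v y)| ≤ M :=
  abs_matrixValue_le fun _ _ => hv _

omit [MeasurableSingletonClass A] [MeasurableSingletonClass B] in
theorem abs_bellman_le (G : MarkovGame S A B) (h : ℕ) {v : S × A × B → ℝ}
    (hv : ∀ s, |v s| ≤ 1) (s : S × A × B) : |G.bellman h v s| ≤ 2 := by
  have h₁ : |G.reward h s| ≤ 1 := abs_le.2 (G.reward_mem h s)
  have h₂ := abs_integral_le_of_abs_le (μ := G.kernel h s) (abs_matrixValue_atState_le hv)
  refine (abs_add_le _ _).trans ?_
  linarith

omit [MeasurableSingletonClass A] [MeasurableSingletonClass B] in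
theorem measurable_regressionGap (G : MarkovGame S A B) (h : ℕ) {u v : S × A × B → ℝ}
    (hu : Measurable u) (hv : Measurable v) :
    Measurable fun q : (S × A × B) × S => G.regressionGap h u v q.1 q.2 := by
  have h₁ : Measurable fun q : (S × A × B) × S => u q.1 := hu.comp measurable_fst
  have h₂ : Measurable fun q : (S × A × B) × S => G.bellman h v q.1 :=
    (G.measurable_bellman h hv).comp measurable_fst
  have h₃ : Measurable fun q : (S × A × B) × S => G.reward h q.1 :=
    (G.measurable_reward h).comp measurable_fst
  have h₄ : Measurable fun q : (S × A × B) × S => matrixValue (atState v q.2) :=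
    (measurable_matrixValue_atState hv).comp measurable_snd
  exact ((((h₁.sub h₂).pow_const 2).div_const 2).sub (((h₁.sub h₃).sub h₄).pow_const 2)).add
    (((h₂.sub h₃).sub h₄).pow_const 2)

omit [MeasurableSingletonClass A] [MeasurableSingletonClass B] in
theorem regressionGap_le (G : MarkovGame S A B) (h : ℕ) {u v : S × A × B → ℝ}
    (hu : ∀ s, |u s| ≤ 1) (hv : ∀ s, |v s| ≤ 1) (s : S × A × B) (y : S) :
    G.regressionGap h u v s y ≤ 21 := by
  have h₁ := abs_le.1 (hu s)
  have h₂ := abs_le.1 (G.abs_bellman_le h hv s)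
  have h₃ := G.reward_mem h s
  have h₄ := abs_le.1 (abs_matrixValue_atState_le hv y)
  have h₅ : (u s - G.bellman h v s) ^ 2 ≤ 3 ^ 2 := sq_le_sq' (by linarith) (by linarith)
  have h₆ : (G.bellman h v s - G.reward h s - matrixValue (atState v y)) ^ 2 ≤ 4 ^ 2 :=
    sq_le_sq' (by linarith [h₃.2]) (by linarith [h₃.1])
  have h₇ := sq_nonneg (u s - G.reward h s - matrixValue (atState v y))
  rw [regressionGap]
  linarith

omit [MeasurableSingletonClass A] [MeasurableSingletonClass B] in
-- With `Δ = u - 𝒯_h v` and `ξ` the centered next-state value, the gap equals `-Δ²/2 + 2Δξ`. Since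
-- `ξ` is sub-Gaussian with variance proxy `1`, at scale `1/4` the noise contributes at most
-- `exp(Δ²/8)`, exactly cancelling the drift.
theorem integral_exp_regressionGap_le (G : MarkovGame S A B) (h : ℕ) {u v : S × A × B → ℝ}
    (hv : Measurable v) (hv1 : ∀ s, |v s| ≤ 1) (s : S × A × B) :
    ∫ y, Real.exp (G.regressionGap h u v s y / 4) ∂(G.kernel h s) ≤ 1 := by
  set X : S → ℝ := fun y => matrixValue (atState v y) with hX
  set m : ℝ := ∫ y, X y ∂(G.kernel h s) with hm
  set Δ : ℝ := u s - G.bellman h v s with hΔ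
  have hXm : Measurable X := measurable_matrixValue_atState hv
  have hmgf := (hasSubgaussianMGF_of_mem_Icc (μ := G.kernel h s) hXm.aemeasurable
    (Filter.Eventually.of_forall fun y =>
      abs_le.1 (abs_matrixValue_atState_le hv1 y))).mgf_le (Δ / 2)
  have hc : ((‖(1 : ℝ) - -1‖₊ / 2) ^ 2 : NNReal) = (1 : NNReal) := by
    have : ‖(1 : ℝ) - -1‖₊ = 2 := by
      rw [← NNReal.coe_inj]; norm_num
    rw [this]; norm_num
  rw [hc] at hmgf
  have hpt : ∀ y, Real.exp (G.regressionGap h u v s y / 4) =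
      Real.exp (-(Δ ^ 2 / 8)) * Real.exp (Δ / 2 * (X y - m)) := by
    intro y
    rw [← Real.exp_add]
    congr 1
    have hb : G.bellman h v s = G.reward h s + m := rfl
    have hu : u s = Δ + (G.reward h s + m) := by rw [hΔ, hb]; ring
    have hXy : matrixValue (atState v y) = X y := rfl
    rw [regressionGap, hXy, hb, hu]
    ring
  simp only [hpt]
  rw [integral_const_mul]
  calc _ ≤ Real.exp (-(Δ ^ 2 / 8)) * Real.exp (((1 : NNReal) : ℝ) * (Δ / 2) ^ 2 / 2) :=
        mul_le_mul_of_nonneg_left hmgf (Real.exp_pos _).le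
    _ = 1 := by
        rw [← Real.exp_add, ← Real.exp_zero, NNReal.coe_one]; congr 1; ring

variable {G : MarkovGame S A B} {F : ℕ → Set (S × A × B → ℝ)} {β : ℝ} {K : ℕ}
  {Ω : Type z} [mΩ : MeasurableSpace Ω] {P : Measure Ω} [IsProbabilityMeasure P]
  {𝓗 : ℕ → ℕ → MeasurableSpace Ω}
  {x : ℕ → ℕ → Ω → S} {a : ℕ → ℕ → Ω → A} {b : ℕ → ℕ → Ω → B}
  {f : ℕ → Ω → ℕ → S × A × B → ℝ} {π : ℕ → Ω → Policy S A} {ν : ℕ → Ω → Policy S B}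

namespace IsRun

omit [MeasurableSingletonClass A] [MeasurableSingletonClass B] [IsProbabilityMeasure P]
  [Nonempty A] [Nonempty B] in
theorem le_of_lt_episode (hrun : G.IsRun F β K P 𝓗 x a b f π ν) {i k : ℕ} (hik : i < k)
    (hk : k < K) {h : ℕ} (hh : h ≤ G.H) : 𝓗 i h ≤ 𝓗 k 0 := by
  induction k, Nat.succ_le_of_lt hik using Nat.le_induction with
  | base => exact (hrun.le_of_le_step (by omega) hh le_rfl).trans (hrun.mono_episode i hk)
  | succ n hn ih =>
    exact ((ih (by omega) (by omega)).trans
      (hrun.le_of_le_step (by omega) (Nat.zero_le _) le_rfl)).trans (hrun.mono_episode n hk)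

omit [MeasurableSingletonClass A] [MeasurableSingletonClass B] [IsProbabilityMeasure P]
  [Nonempty A] [Nonempty B] in
theorem measurable_stateActions (hrun : G.IsRun F β K P 𝓗 x a b f π ν) {k h : ℕ} (hk : k < K)
    (hh : h < G.H) : Measurable[𝓗 k (h + 1)] fun ω => (x k h ω, a k h ω, b k h ω) :=
  ((hrun.measurable_state k hk h hh.le).mono (hrun.mono_step k hk h hh) le_rfl).prodMk
    ((hrun.measurable_action₁ k hk h hh).prodMk (hrun.measurable_action₂ k hk h hh))

omit [MeasurableSingletonClass A] [MeasurableSingletonClass B] [IsProbabilityMeasure P] in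
theorem measurable_gap (hrun : G.IsRun F β K P 𝓗 x a b f π ν) {k h : ℕ} (hk : k < K)
    (hh : h < G.H) {u v : S × A × B → ℝ} (hu : Measurable u) (hv : Measurable v) :
    Measurable[𝓗 k (h + 1)] fun ω =>
      G.regressionGap h u v (x k h ω, a k h ω, b k h ω) (x k (h + 1) ω) := by
  have h₁ : Measurable[𝓗 k (h + 1)] fun ω =>
      ((x k h ω, a k h ω, b k h ω), x k (h + 1) ω) :=
    (hrun.measurable_stateActions hk hh).prodMk (hrun.measurable_state k hk (h + 1) hh)
  have h₂ := (G.measurable_regressionGap h hu hv).comp h₁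
  exact h₂

/-- The exponential is a supermartingale over episodes: given the past and any actions, the new
factor has mean at most `1`, whatever the opponent does. -/
theorem integral_exp_sum_regressionGap_le (hrun : G.IsRun F β K P 𝓗 x a b f π ν) {h : ℕ}
    (hh : h < G.H) {u v : S × A × B → ℝ} (hu : Measurable u) (hu1 : ∀ s, |u s| ≤ 1)
    (hv : Measurable v) (hv1 : ∀ s, |v s| ≤ 1) (k : ℕ) (hk : k ≤ K) :
    ∫ ω, Real.exp (∑ i ∈ Finset.range k,
      G.regressionGap h u v (x i h ω, a i h ω, b i h ω) (x i (h + 1) ω) / 4) ∂P ≤ 1 := by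
  induction k with
  | zero => simp
  | succ k ih =>
    have hkK : k < K := by omega
    set Z : Ω → ℝ := fun ω => Real.exp (∑ i ∈ Finset.range k,
      G.regressionGap h u v (x i h ω, a i h ω, b i h ω) (x i (h + 1) ω) / 4) with hZ
    have hZm : Measurable[𝓗 k h] Z := by
      refine Real.measurable_exp.comp (Finset.measurable_sum _ fun i hi => ?_)
      have hik := Finset.mem_range.1 hi
      exact ((hrun.measurable_gap (hik.trans hkK) hh hu hv).div_const 4).mono
        ((hrun.le_of_lt_episode hik hkK hh).trans
          (hrun.le_of_le_step hkK (Nat.zero_le _) hh.le)) le_rfl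
    have hZ0 : ∀ ω, 0 < Z ω := fun ω => Real.exp_pos _
    have hgap4 : ∀ s y, G.regressionGap h u v s y / 4 ≤ 6 := fun s y => by
      linarith [G.regressionGap_le h hu1 hv1 s y]
    have hZb : ∀ ω, |Z ω| ≤ Real.exp (k * 6) := fun ω => by
      rw [abs_of_pos (hZ0 ω)]
      exact Real.exp_le_exp.2 ((Finset.sum_le_sum fun i _ => hgap4 _ _).trans_eq (by simp))
    have hZm' : Measurable Z := hZm.mono (hrun.le_space k hkK h hh.le) le_rfl
    let Φ : A → B → Ω × S → ℝ := fun i j q =>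
      Z q.1 * Real.exp (G.regressionGap h u v (x k h q.1, i, j) q.2 / 4)
    have hΦm : ∀ i j, Measurable[(𝓗 k h).prod ‹MeasurableSpace S›] (Φ i j) := fun i j => by
      have h₁ : Measurable[(𝓗 k h).prod ‹MeasurableSpace S›, 𝓗 k h] fun q : Ω × S => q.1 :=
        @measurable_fst Ω S (𝓗 k h) _
      have h₂ : Measurable[(𝓗 k h).prod ‹MeasurableSpace S›] fun q : Ω × S => q.2 :=
        @measurable_snd Ω S (𝓗 k h) _
      have h₃ : Measurable[(𝓗 k h).prod ‹MeasurableSpace S›] fun q : Ω × S =>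
          ((x k h q.1, i, j), q.2) :=
        (((hrun.measurable_state k hkK h hh.le).comp h₁).prodMk
          (@measurable_const _ _ _ ((𝓗 k h).prod ‹MeasurableSpace S›) (i, j))).prodMk h₂
      have h₄ := (G.measurable_regressionGap h hu hv).comp h₃
      exact (hZm.comp h₁).mul (Real.measurable_exp.comp (h₄.div_const 4))
    have hΦb : ∀ i j q, |Φ i j q| ≤ Real.exp (k * 6) * Real.exp 6 := fun i j q => by
      rw [abs_mul, abs_of_pos (Real.exp_pos (_ / 4))]
      exact mul_le_mul (hZb _) (Real.exp_le_exp.2 (hgap4 _ _)) (Real.exp_pos _).le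
        (Real.exp_pos _).le
    have hstep := hrun.integral_step hkK hh hΦm hΦb
    have hle : ∀ ω, mixedPayoff (fun i j => ∫ y, Φ i j (ω, y) ∂(G.kernel h (x k h ω, i, j)))
        ((π k ω).prob h (x k h ω)) ((ν k ω).prob h (x k h ω)) ≤ Z ω := fun ω => by
      have hπ := (π k ω).prob_mem h (x k h ω)
      have hν := (ν k ω).prob_mem h (x k h ω)
      rw [← mixedPayoff_const (Z ω) hπ hν]
      refine mixedPayoff_mono hπ hν fun i j => ?_
      simp only [Φ]
      rw [integral_const_mul]
      exact mul_le_of_le_one_right (hZ0 ω).le (G.integral_exp_regressionGap_le h hv hv1 _)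
    calc _ = ∫ ω, Φ (a k h ω) (b k h ω) (ω, x k (h + 1) ω) ∂P := by
          refine integral_congr_ae (Filter.Eventually.of_forall fun ω => ?_)
          simp only [Finset.sum_range_succ, Real.exp_add, Φ, hZ]
      _ ≤ ∫ ω, Z ω ∂P := by
          rw [hstep]
          refine integral_mono_of_nonneg (Filter.Eventually.of_forall fun ω => ?_)
            (integrable_of_abs_le hZm' hZb) (Filter.Eventually.of_forall hle)
          have hπ := (π k ω).prob_mem h (x k h ω)
          have hν := (ν k ω).prob_mem h (x k h ω)
          rw [Pi.zero_apply, ← mixedPayoff_const 0 hπ hν]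
          exact mixedPayoff_mono hπ hν fun i j => integral_nonneg fun y =>
            mul_nonneg (hZ0 ω).le (Real.exp_pos _).le
      _ ≤ 1 := ih (by omega)

/-- Concentration of the squared Bellman loss around its minimizer, for a fixed pair of
functions. -/
theorem measure_regression_le (hrun : G.IsRun F β K P 𝓗 x a b f π ν) {h : ℕ}
    (hh : h < G.H) {u v : S × A × B → ℝ} (hu : Measurable u) (hu1 : ∀ s, |u s| ≤ 1)
    (hv : Measurable v) (hv1 : ∀ s, |v s| ≤ 1) {k : ℕ} (hk : k ≤ K) (ℓ : ℝ) :
    P {ω | G.loss (fun i h => x i h ω) (fun i h => a i h ω) (fun i h => b i h ω) k h u v -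
        G.loss (fun i h => x i h ω) (fun i h => a i h ω) (fun i h => b i h ω) k h
          (G.bellman h v) v + 4 * ℓ <
        (∑ i ∈ Finset.range k, (u (x i h ω, a i h ω, b i h ω) -
          G.bellman h v (x i h ω, a i h ω, b i h ω)) ^ 2) / 2} ≤
      ENNReal.ofReal (Real.exp (-ℓ)) := by
  have hX : Measurable fun ω => ∑ i ∈ Finset.range k,
      G.regressionGap h u v (x i h ω, a i h ω, b i h ω) (x i (h + 1) ω) / 4 :=
    Finset.measurable_sum _ fun i hi => by
      have hik : i < K := (Finset.mem_range.1 hi).trans_le hk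
      exact ((hrun.measurable_gap hik hh hu hv).div_const 4).mono
        (hrun.le_space i hik (h + 1) hh) le_rfl
  have hM : ∀ ω, ∑ i ∈ Finset.range k,
      G.regressionGap h u v (x i h ω, a i h ω, b i h ω) (x i (h + 1) ω) / 4 ≤ k * 6 := fun ω =>
    (Finset.sum_le_sum fun i _ => (by
      linarith [G.regressionGap_le h hu1 hv1 (x i h ω, a i h ω, b i h ω) (x i (h + 1) ω)] :
        _ ≤ (6 : ℝ))).trans_eq (by simp)
  have := measure_lt_le_exp_neg (P := P) hX hM (q := 0) (by
    rw [Real.exp_zero]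
    exact hrun.integral_exp_sum_regressionGap_le hh hu hu1 hv hv1 k hk) ℓ
  rw [zero_sub] at this
  refine (measure_mono fun ω hω => ?_).trans this
  rw [Set.mem_ofPred_eq] at hω ⊢
  rw [← Finset.sum_div]
  simp only [regressionGap, Finset.sum_add_distrib, Finset.sum_sub_distrib, ← Finset.sum_div]
  simp only [loss] at hω
  linarith

end IsRun
end MarkovGame

/-! ### Bellman residuals: regret decomposition and passage to realized trajectories. -/

namespace MarkovGame

variable {S : Type u} {A : Type v} {B : Type w}
  [MeasurableSpace S] [MeasurableSpace A] [MeasurableSpace B] [Fintype A] [Fintype B]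

/-- The Bellman residual `f_h - 𝒯_h f_{h+1}`. -/
noncomputable def residual (G : MarkovGame S A B) (f : ℕ → S × A × B → ℝ) (h : ℕ)
    (s : S × A × B) : ℝ :=
  f h s - G.bellman h (f (h + 1)) s

section ValueClass

variable {G : MarkovGame S A B} {F : ℕ → Set (S × A × B → ℝ)}

omit [Fintype A] [Fintype B] in
theorem IsNormalized.measurable_of_mem (hN : G.IsNormalized F) {f : ℕ → S × A × B → ℝ}
    (hf : f ∈ G.valueClass F) (h : ℕ) : Measurable (f h) := by
  rcases lt_or_ge h G.H with hh | hh
  · exact (hN h hh _ (hf.1 h hh)).1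
  · rw [hf.2 h hh]; exact measurable_const

omit [Fintype A] [Fintype B] in
theorem IsNormalized.abs_le_one_of_mem (hN : G.IsNormalized F) {f : ℕ → S × A × B → ℝ}
    (hf : f ∈ G.valueClass F) (h : ℕ) (s : S × A × B) : |f h s| ≤ 1 := by
  rcases lt_or_ge h G.H with hh | hh
  · exact abs_le.2 ((hN h hh _ (hf.1 h hh)).2 s)
  · rw [hf.2 h hh]; simp

/-- Completeness places the Bellman image in the normalized class, improving the general bound `2`.
-/
theorem Complete.abs_bellman_le_one (hC : G.Complete F) (hN : G.IsNormalized F)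
    {f : ℕ → S × A × B → ℝ} (hf : f ∈ G.valueClass F) {h : ℕ} (hh : h < G.H) (s : S × A × B) :
    |G.bellman h (f (h + 1)) s| ≤ 1 :=
  abs_le.2 ((hN h hh _ (hC f hf h hh)).2 s)

theorem Complete.measurable_residual (hC : G.Complete F) (hN : G.IsNormalized F)
    {f : ℕ → S × A × B → ℝ} (hf : f ∈ G.valueClass F) {h : ℕ} (hh : h < G.H) :
    Measurable (G.residual f h) :=
  (hN.measurable_of_mem hf h).sub (hN h hh _ (hC f hf h hh)).1

theorem Complete.abs_residual_le_two (hC : G.Complete F) (hN : G.IsNormalized F)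
    {f : ℕ → S × A × B → ℝ} (hf : f ∈ G.valueClass F) {h : ℕ} (hh : h < G.H) (s : S × A × B) :
    |G.residual f h s| ≤ 2 := by
  refine (abs_sub _ _).trans ?_
  linarith [hN.abs_le_one_of_mem hf h s, hC.abs_bellman_le_one hN hf hh s]

/-- If player 1 plays max-min strategies for `f`, then the value predicted by `f` exceeds the value
of the policies by at most the expected sum of the Bellman residuals. -/
theorem matrixValue_sub_le_expectedSum_residual [MeasurableSingletonClass A]
    [MeasurableSingletonClass B] [Nonempty A] [Nonempty B] (hC : G.Complete F)
    (hN : G.IsNormalized F) {f : ℕ → S × A × B → ℝ} (hf : f ∈ G.valueClass F) {π : Policy S A}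
    (hπ : ∀ h < G.H, ∀ y, guarantee (atState (f h) y) (π.prob h y) = matrixValue (atState (f h) y))
    (ν : Policy S B) (n : ℕ) : ∀ h, n + h = G.H → ∀ x,
      matrixValue (atState (f h) x) - G.expectedReward π ν n h x ≤
        G.expectedSum (G.residual f) π ν n h x := by
  induction n with
  | zero =>
    intro h hh x
    rw [hf.2 h (by omega)]
    simp only [expectedReward, expectedSum, sub_zero]
    exact matrixValue_zero.le
  | succ n ih =>
    intro h hh x
    have hhH : h < G.H := by omega
    have hsimπ := π.prob_mem h x
    have hsimν := ν.prob_mem h x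
    -- The only use of the max-min choice: it holds against the opponent's actual strategy, unknown
    -- to player 1.
    have h₁ : matrixValue (atState (f h) x) ≤
        mixedPayoff (atState (f h) x) (π.prob h x) (ν.prob h x) := by
      rw [← hπ h hhH x]; exact guarantee_le _ hsimπ hsimν
    have h₂ : mixedPayoff (atState (f h) x) (π.prob h x) (ν.prob h x) -
        G.expectedReward π ν (n + 1) h x ≤ G.expectedSum (G.residual f) π ν (n + 1) h x := by
      simp only [expectedReward, expectedSum]
      rw [← mixedPayoff_sub]
      refine mixedPayoff_mono hsimπ hsimν fun a b => ?_
      have hvm := measurable_matrixValue_atState (hN.measurable_of_mem hf (h + 1))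
      have hvb := abs_matrixValue_atState_le (hN.abs_le_one_of_mem hf (h + 1))
      have hrm := G.measurable_expectedReward π ν n (h + 1)
      have hrb := G.abs_expectedReward_le π ν n (h + 1)
      have hem : Measurable (G.expectedSum (G.residual f) π ν n (h + 1)) := by
        have := G.measurable_expectedSum (T := Unit) (ρ := fun _ => G.residual f)
          (π := fun _ => π) (ν := fun _ => ν) n (h + 1)
          (fun i hi a b => (hC.measurable_residual hN hf (by omega)).comp
            (measurable_snd.prodMk (measurable_const (a := ((a, b) : A × B)))))
          (fun i _ a => (π.measurable_prob i a).comp measurable_snd)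
          (fun i _ b => (ν.measurable_prob i b).comp measurable_snd)
        exact this.comp
          (measurable_const.prodMk measurable_id : Measurable fun x : S => (Unit.unit, x))
      have heb := G.abs_expectedSum_le (ρ := G.residual f) π ν n (h + 1)
        (fun i hi => hC.abs_residual_le_two hN hf (by omega))
      have h₃ : ∫ y, matrixValue (atState (f (h + 1)) y) ∂(G.kernel h (x, a, b)) ≤
          ∫ y, G.expectedReward π ν n (h + 1) y ∂(G.kernel h (x, a, b)) +
          ∫ y, G.expectedSum (G.residual f) π ν n (h + 1) y ∂(G.kernel h (x, a, b)) := by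
        rw [← integral_add (integrable_of_abs_le hrm hrb) (integrable_of_abs_le hem heb)]
        exact integral_mono (integrable_of_abs_le hvm hvb)
          ((integrable_of_abs_le hrm hrb).add (integrable_of_abs_le hem heb)) fun y => by
            have := ih (h + 1) (by omega) y
            simp only; linarith
      simp only [residual, bellman, atState]
      linarith
    linarith

end ValueClass

theorem measurable_bellman_joint [MeasurableSingletonClass A] [MeasurableSingletonClass B]
    [Nonempty A] [Nonempty B] {T : Type*} [MeasurableSpace T] (G : MarkovGame S A B) (h : ℕ)
    {v : T → S × A × B → ℝ} (hv : ∀ a b, Measurable fun q : T × S => v q.1 (q.2, a, b))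
    (a : A) (b : B) : Measurable fun q : T × S => G.bellman h (v q.1) (q.2, a, b) := by
  have h₁ : Measurable fun q : T × S => matrixValue (atState (v q.1) q.2) :=
    measurable_matrixValue hv
  have h₂ : Measurable fun q : T × S => (q.2, a, b) :=
    measurable_snd.prodMk (measurable_const (a := ((a, b) : A × B)))
  have h₃ : Measurable fun q : T × S => G.reward h (q.2, a, b) := (G.measurable_reward h).comp h₂
  exact h₃.add (G.measurable_integral_kernel h a b h₁)

variable [MeasurableSingletonClass A] [MeasurableSingletonClass B]
  {G : MarkovGame S A B} {F : ℕ → Set (S × A × B → ℝ)} {β : ℝ} {K : ℕ}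
  {Ω : Type z} [mΩ : MeasurableSpace Ω] {P : Measure Ω} [IsProbabilityMeasure P]
  {𝓗 : ℕ → ℕ → MeasurableSpace Ω}
  {x : ℕ → ℕ → Ω → S} {a : ℕ → ℕ → Ω → A} {b : ℕ → ℕ → Ω → B}
  {f : ℕ → Ω → ℕ → S × A × B → ℝ} {π : ℕ → Ω → Policy S A} {ν : ℕ → Ω → Policy S B}

namespace IsRun

omit [MeasurableSingletonClass B] [MeasurableSingletonClass A] [IsProbabilityMeasure P] in
theorem mem_valueClass (hrun : G.IsRun F β K P 𝓗 x a b f π ν) {k : ℕ} (hk : k < K) (ω : Ω) :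
    f k ω ∈ G.valueClass F :=
  (hrun.mem_confidenceSet k hk ω).1

omit [IsProbabilityMeasure P] in
theorem measurable_residual_joint [Nonempty A] [Nonempty B]
    (hrun : G.IsRun F β K P 𝓗 x a b f π ν) {k h : ℕ} (hk : k < K) (hh : h < G.H) (i : A) (j : B) :
    Measurable[(𝓗 k 0).prod ‹MeasurableSpace S›] fun q : Ω × S =>
      G.residual (f k q.1) h (q.2, i, j) := by
  have hf : ∀ i j, Measurable[(𝓗 k 0).prod ‹MeasurableSpace S›] fun q : Ω × S =>
      f k q.1 (h + 1) (q.2, i, j) := fun i j => by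
    rcases lt_or_ge (h + 1) G.H with hh' | hh'
    · exact hrun.measurable_f k hk (h + 1) hh' i j
    -- At the last step the continuation is the default `0`, about which `measurable_f` says
    -- nothing.
    · have : (fun q : Ω × S => f k q.1 (h + 1) (q.2, i, j)) = fun _ => 0 := by
        funext q
        rw [(hrun.mem_valueClass hk q.1).2 (h + 1) hh', Pi.zero_apply]
      rw [this]
      exact @measurable_const _ _ _ ((𝓗 k 0).prod _) 0
  have hb := @measurable_bellman_joint S A B _ _ _ _ _ _ _ _ _ Ω (𝓗 k 0) G h
    (fun ω => f k ω (h + 1)) hf i j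
  exact (hrun.measurable_f k hk h hh i j).sub hb

omit [IsProbabilityMeasure P] in
-- The actions take finitely many values, so measurability for each fixed action pair suffices.
theorem measurable_apply_stateActions (hrun : G.IsRun F β K P 𝓗 x a b f π ν) {k h : ℕ}
    (hk : k < K) (hh : h < G.H) {ρ : Ω → ℕ → S × A × B → ℝ}
    (hρ : ∀ i j, Measurable[(𝓗 k 0).prod ‹MeasurableSpace S›] fun q : Ω × S =>
      ρ q.1 h (q.2, i, j)) :
    Measurable[𝓗 k (h + 1)] fun ω => ρ ω h (x k h ω, a k h ω, b k h ω) := by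
  have hx : Measurable[𝓗 k (h + 1)] (x k h) :=
    (hrun.measurable_state k hk h hh.le).mono (hrun.mono_step k hk h hh) le_rfl
  have h₁ : Measurable[Prod.instMeasurableSpace.prod (𝓗 k (h + 1))]
      fun q : (A × B) × Ω => ρ q.2 h (x k h q.2, q.1) :=
    @measurable_from_prod_countable_right _ _ _ _ (𝓗 k (h + 1)) _ _ _ _ fun q =>
      measurable_comp_prodMk_of_le (hrun.le_of_le_step hk (Nat.zero_le _) hh) (hρ q.1 q.2) hx
  have h₂ : Measurable[𝓗 k (h + 1), Prod.instMeasurableSpace.prod (𝓗 k (h + 1))]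
      fun ω => ((a k h ω, b k h ω), ω) :=
    @Measurable.prodMk _ (𝓗 k (h + 1)) _ _ _ (𝓗 k (h + 1)) _ _
      ((hrun.measurable_action₁ k hk h hh).prodMk (hrun.measurable_action₂ k hk h hh))
      (@measurable_id _ (𝓗 k (h + 1)))
  have h₃ := h₁.comp h₂
  exact h₃

/-- Weighted by the information at the start of the episode, the expected sum of step rewards
has the same mean as the sum along the realized trajectory. -/
theorem integral_mul_expectedSum (hrun : G.IsRun F β K P 𝓗 x a b f π ν) {k : ℕ} (hk : k < K)
    {ρ : Ω → ℕ → S × A × B → ℝ}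
    (hρ : ∀ h < G.H, ∀ i j, Measurable[(𝓗 k 0).prod ‹MeasurableSpace S›] fun q : Ω × S =>
      ρ q.1 h (q.2, i, j)) {M : ℝ} (hM : ∀ ω, ∀ h < G.H, ∀ s, |ρ ω h s| ≤ M)
    {W : Ω → ℝ} (hW : Measurable[𝓗 k 0] W) {M' : ℝ} (hM' : ∀ ω, |W ω| ≤ M') (n : ℕ) :
    ∀ h, n + h = G.H →
      ∫ ω, W ω * G.expectedSum (ρ ω) (π k ω) (ν k ω) n h (x k h ω) ∂P =
      ∫ ω, W ω * ∑ i ∈ Finset.range n,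
        ρ ω (h + i) (x k (h + i) ω, a k (h + i) ω, b k (h + i) ω) ∂P := by
  induction n with
  | zero => intro h _; simp [expectedSum]
  | succ n ih =>
    intro h hh
    have hhH : h < G.H := by omega
    have h0 : 𝓗 k 0 ≤ 𝓗 k h := hrun.le_of_le_step hk (Nat.zero_le _) hhH.le
    have hle0 := hrun.le_space k hk 0 (Nat.zero_le _)
    have hle' := hrun.le_space k hk (h + 1) hhH
    have hx := hrun.measurable_state k hk h hhH.le
    have hE : Measurable[(𝓗 k 0).prod ‹MeasurableSpace S›] fun q : Ω × S =>
        G.expectedSum (ρ q.1) (π k q.1) (ν k q.1) n (h + 1) q.2 :=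
      @measurable_expectedSum S A B _ _ _ _ _ Ω (𝓗 k 0) _ _ G ρ (π k) (ν k) n (h + 1)
        (fun i hi => hρ i (by omega)) (fun i hi => hrun.measurable_π k hk i (by omega))
        (fun i hi => hrun.measurable_ν k hk i (by omega))
    have hEb : ∀ ω y, |G.expectedSum (ρ ω) (π k ω) (ν k ω) n (h + 1) y| ≤ n * M := fun ω =>
      G.abs_expectedSum_le (π k ω) (ν k ω) n (h + 1) fun i hi => hM ω i (by omega)
    -- Current step reward plus the conditional expectation of the rest. Policies and step rewards
    -- are known at the start of the episode, so the recursion may be applied with `ω` frozen.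
    let Φ : A → B → Ω × S → ℝ := fun i j q => W q.1 * (ρ q.1 h (x k h q.1, i, j) +
      G.expectedSum (ρ q.1) (π k q.1) (ν k q.1) n (h + 1) q.2)
    have hΦ : ∀ i j, Measurable[(𝓗 k h).prod ‹MeasurableSpace S›] (Φ i j) := fun i j => by
      have h₁ : Measurable[(𝓗 k h).prod ‹MeasurableSpace S›, 𝓗 k h] fun q : Ω × S => q.1 :=
        @measurable_fst Ω S (𝓗 k h) _
      have h₂ : Measurable[𝓗 k h] W := hW.mono h0 le_rfl
      have h₃ : Measurable[𝓗 k h] fun ω => ρ ω h (x k h ω, i, j) :=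
        measurable_comp_prodMk_of_le h0 (hρ h hhH i j) hx
      exact (h₂.comp h₁).mul ((h₃.comp h₁).add (measurable_prod_of_le h0 hE))
    have hΦb : ∀ i j q, |Φ i j q| ≤ M' * (M + n * M) := fun i j q => by
      rw [abs_mul]
      exact mul_le_mul (hM' _) ((abs_add_le _ _).trans (add_le_add (hM _ h hhH _) (hEb _ _)))
        (abs_nonneg _) ((abs_nonneg _).trans (hM' q.1))
    have hstep := hrun.integral_step hk hhH hΦ hΦb
    have hlhs : ∀ ω, W ω * G.expectedSum (ρ ω) (π k ω) (ν k ω) (n + 1) h (x k h ω) =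
        mixedPayoff (fun i j => ∫ y, Φ i j (ω, y) ∂(G.kernel h (x k h ω, i, j)))
          ((π k ω).prob h (x k h ω)) ((ν k ω).prob h (x k h ω)) := fun ω => by
      have hEω : Measurable fun y => G.expectedSum (ρ ω) (π k ω) (ν k ω) n (h + 1) y :=
        (measurable_prod_of_le hle0 hE).comp measurable_prodMk_left
      rw [expectedSum, ← mixedPayoff_const_mul]
      congr 1
      funext i j
      simp only [Φ]
      rw [integral_const_mul, integral_add (integrable_const _)
        (integrable_of_abs_le hEω (hEb ω)), integral_const]
      simp
    have hWm : Measurable W := hW.mono hle0 le_rfl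
    have hρm : ∀ i < G.H, Measurable fun ω => ρ ω i (x k i ω, a k i ω, b k i ω) := fun i hi =>
      (hrun.measurable_apply_stateActions hk hi (hρ i hi)).mono
        (hrun.le_space k hk (i + 1) hi) le_rfl
    have hEx : Measurable fun ω =>
        G.expectedSum (ρ ω) (π k ω) (ν k ω) n (h + 1) (x k (h + 1) ω) :=
      measurable_comp_prodMk_of_le hle0 hE
        ((hrun.measurable_state k hk (h + 1) hhH).mono hle' le_rfl)
    have hI₁ : Integrable (fun ω => W ω * ρ ω h (x k h ω, a k h ω, b k h ω)) P :=
      integrable_of_abs_le (M := M' * M) (hWm.mul (hρm h hhH)) fun ω => by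
        rw [abs_mul]
        exact mul_le_mul (hM' _) (hM _ h hhH _) (abs_nonneg _) ((abs_nonneg _).trans (hM' ω))
    have hI₂ : Integrable (fun ω => W ω *
        G.expectedSum (ρ ω) (π k ω) (ν k ω) n (h + 1) (x k (h + 1) ω)) P :=
      integrable_of_abs_le (M := M' * (n * M)) (hWm.mul hEx) fun ω => by
        rw [abs_mul]
        exact mul_le_mul (hM' _) (hEb _ _) (abs_nonneg _) ((abs_nonneg _).trans (hM' ω))
    have hI₃ : Integrable (fun ω => W ω * ∑ i ∈ Finset.range n,
        ρ ω (h + 1 + i) (x k (h + 1 + i) ω, a k (h + 1 + i) ω, b k (h + 1 + i) ω)) P := by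
      refine integrable_of_abs_le (M := M' * (n * M)) (hWm.mul (Finset.measurable_sum _
        fun i hi => hρm _ (by have := Finset.mem_range.1 hi; omega))) fun ω => ?_
      rw [abs_mul]
      refine mul_le_mul (hM' _) ((Finset.abs_sum_le_sum_abs _ _).trans ?_) (abs_nonneg _)
        ((abs_nonneg _).trans (hM' ω))
      refine (Finset.sum_le_sum fun i hi => hM ω (h + 1 + i) ?_ _).trans_eq (by simp)
      have := Finset.mem_range.1 hi; omega
    calc ∫ ω, W ω * G.expectedSum (ρ ω) (π k ω) (ν k ω) (n + 1) h (x k h ω) ∂P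
        = ∫ ω, Φ (a k h ω) (b k h ω) (ω, x k (h + 1) ω) ∂P := by
          rw [hstep]; exact integral_congr_ae (Filter.Eventually.of_forall hlhs)
      _ = ∫ ω, W ω * ρ ω h (x k h ω, a k h ω, b k h ω) ∂P + ∫ ω, W ω *
            G.expectedSum (ρ ω) (π k ω) (ν k ω) n (h + 1) (x k (h + 1) ω) ∂P := by
          rw [← integral_add hI₁ hI₂]
          exact integral_congr_ae (Filter.Eventually.of_forall fun ω => mul_add _ _ _)
      _ = _ := by
          rw [ih (h + 1) (by omega), ← integral_add hI₁ hI₃]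
          refine integral_congr_ae (Filter.Eventually.of_forall fun ω => ?_)
          simp only [Finset.sum_range_succ', add_zero, mul_add, add_assoc, add_comm 1]
          ring

/-- With high probability, the total expected sums of the Bellman residuals are close to the sums
along the realized trajectories. -/
theorem measure_expectedSum_residual_gt_le [Nonempty A] [Nonempty B]
    (hrun : G.IsRun F β K P 𝓗 x a b f π ν) (hC : G.Complete F) (hN : G.IsNormalized F)
    (hH : 0 < G.H) (hK : 0 < K) {ℓ : ℝ} (hℓ : 0 ≤ ℓ) :
    P {ω | 4 * G.H * √(2 * K * ℓ) < ∑ k ∈ Finset.range K,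
        (G.expectedSum (G.residual (f k ω)) (π k ω) (ν k ω) G.H 0 (x k 0 ω) -
          ∑ h ∈ Finset.range G.H, G.residual (f k ω) h (x k h ω, a k h ω, b k h ω))} ≤
      ENNReal.ofReal (Real.exp (-ℓ)) := by
  have hH' : (0 : ℝ) < G.H := Nat.cast_pos.2 hH
  let Y : ℕ → Ω → ℝ := fun k ω =>
    G.expectedSum (G.residual (f k ω)) (π k ω) (ν k ω) G.H 0 (x k 0 ω) -
      ∑ h ∈ Finset.range G.H, G.residual (f k ω) h (x k h ω, a k h ω, b k h ω)
  have hres : ∀ k < K, ∀ ω, ∀ h < G.H, ∀ s, |G.residual (f k ω) h s| ≤ 2 := fun k hk ω h hh =>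
    hC.abs_residual_le_two hN (hrun.mem_valueClass hk ω) hh
  have hE : ∀ k < K, Measurable[𝓗 k 0] fun ω =>
      G.expectedSum (G.residual (f k ω)) (π k ω) (ν k ω) G.H 0 (x k 0 ω) := fun k hk =>
    measurable_comp_prodMk_of_le (F := fun q : Ω × S =>
        G.expectedSum (G.residual (f k q.1)) (π k q.1) (ν k q.1) G.H 0 q.2) le_rfl
      (@measurable_expectedSum S A B _ _ _ _ _ Ω (𝓗 k 0) _ _ G (fun ω => G.residual (f k ω))
        (π k) (ν k) G.H 0 (fun i hi => hrun.measurable_residual_joint hk (by omega))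
        (fun i hi => hrun.measurable_π k hk i (by omega))
        (fun i hi => hrun.measurable_ν k hk i (by omega)))
      (hrun.measurable_state k hk 0 (Nat.zero_le _))
  have hR : ∀ k < K, Measurable[𝓗 k G.H] fun ω => ∑ h ∈ Finset.range G.H,
      G.residual (f k ω) h (x k h ω, a k h ω, b k h ω) := fun k hk =>
    Finset.measurable_sum _ fun h hh =>
      (hrun.measurable_apply_stateActions hk (Finset.mem_range.1 hh)
        (hrun.measurable_residual_joint hk (Finset.mem_range.1 hh))).mono
        (hrun.le_of_le_step hk (Finset.mem_range.1 hh) le_rfl) le_rfl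
  have hYm : ∀ k < K, Measurable[𝓗 k G.H] (Y k) := fun k hk =>
    ((hE k hk).mono (hrun.le_of_le_step hk (Nat.zero_le _) le_rfl) le_rfl).sub (hR k hk)
  have hEb : ∀ k < K, ∀ ω,
      |G.expectedSum (G.residual (f k ω)) (π k ω) (ν k ω) G.H 0 (x k 0 ω)| ≤ G.H * 2 :=
    fun k hk ω => G.abs_expectedSum_le (π k ω) (ν k ω) G.H 0
      (fun i hi => hres k hk ω i (by omega)) _
  have hRb : ∀ k < K, ∀ ω, |∑ h ∈ Finset.range G.H,
      G.residual (f k ω) h (x k h ω, a k h ω, b k h ω)| ≤ G.H * 2 := fun k hk ω =>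
    (Finset.abs_sum_le_sum_abs _ _).trans ((Finset.sum_le_sum fun h hh =>
      hres k hk ω h (Finset.mem_range.1 hh) _).trans_eq (by simp))
  have hYb : ∀ k < K, ∀ ω, |Y k ω| ≤ 4 * G.H := fun k hk ω =>
    (abs_sub _ _).trans (by linarith [hEb k hk ω, hRb k hk ω])
  refine measure_sum_gt_le_of_orthogonal (Y := Y) (by positivity) hK hℓ
    (fun k hk => (hYm k hk).mono (hrun.le_space k hk _ le_rfl) le_rfl) hYb fun t k hk => ?_
  -- This weight is known when episode `k` starts, so `integral_mul_expectedSum` yields the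
  -- orthogonality.
  set W : Ω → ℝ := fun ω => Real.exp (t * ∑ j ∈ Finset.range k, Y j ω) with hW
  have hWm : Measurable[𝓗 k 0] W :=
    Real.measurable_exp.comp (Measurable.const_mul (Finset.measurable_sum _ fun j hj =>
      (hYm j ((Finset.mem_range.1 hj).trans hk)).mono
        (hrun.le_of_lt_episode (Finset.mem_range.1 hj) hk le_rfl) le_rfl) t)
  have hWb : ∀ ω, |W ω| ≤ Real.exp (|t| * (k * (4 * G.H))) := fun ω => by
    rw [abs_of_pos (Real.exp_pos _)]
    refine Real.exp_le_exp.2 ((le_abs_self _).trans ?_)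
    rw [abs_mul]
    refine mul_le_mul_of_nonneg_left ((Finset.abs_sum_le_sum_abs _ _).trans ?_) (abs_nonneg t)
    exact (Finset.sum_le_sum fun j hj => hYb j ((Finset.mem_range.1 hj).trans hk) ω).trans_eq
      (by simp)
  have hle0 := hrun.le_space k hk 0 (Nat.zero_le _)
  have hI₁ : Integrable (fun ω => W ω *
      G.expectedSum (G.residual (f k ω)) (π k ω) (ν k ω) G.H 0 (x k 0 ω)) P :=
    integrable_of_abs_le ((hWm.mul (hE k hk)).mono hle0 le_rfl) fun ω => by
      rw [abs_mul]
      exact mul_le_mul (hWb ω) (hEb k hk ω) (abs_nonneg _) (Real.exp_pos _).le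
  have hI₂ : Integrable (fun ω => W ω * ∑ h ∈ Finset.range G.H,
      G.residual (f k ω) h (x k h ω, a k h ω, b k h ω)) P :=
    integrable_of_abs_le ((hWm.mono hle0 le_rfl).mul
      ((hR k hk).mono (hrun.le_space k hk _ le_rfl) le_rfl)) fun ω => by
      rw [abs_mul]
      exact mul_le_mul (hWb ω) (hRb k hk ω) (abs_nonneg _) (Real.exp_pos _).le
  have heq := hrun.integral_mul_expectedSum hk (ρ := fun ω => G.residual (f k ω))
    (fun h hh => hrun.measurable_residual_joint hk hh) (hres k hk) hWm hWb G.H 0 rfl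
  simp only [zero_add] at heq
  simp only [Y, mul_sub]
  rw [integral_sub hI₁ hI₂, heq, sub_self]

end IsRun
end MarkovGame

/-! ### Covers, the good event and the regret bound on it. -/

theorem Real.sqrt_le_mul_sqrt {c y z : ℝ} (hc : 0 ≤ c) (h : y ≤ c ^ 2 * z) : √y ≤ c * √z := by
  rw [← Real.sqrt_sq hc, ← Real.sqrt_mul (sq_nonneg c)]
  exact Real.sqrt_le_sqrt h

namespace MarkovGame

variable {S : Type u} {A : Type v} {B : Type w}
  [MeasurableSpace S] [MeasurableSpace A] [MeasurableSpace B] [Fintype A] [Fintype B]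

omit [Fintype A] [Fintype B] in
theorem exists_cover_of_coveringNumber_eq {G : MarkovGame S A B} {F : ℕ → Set (S × A × B → ℝ)}
    {ε : ℝ} {N : ℕ} (hcov : G.coveringNumber F ε = N) :
    ∃ t : Finset (ℕ → S × A × B → ℝ), t.card ≤ N ∧ (∀ u ∈ t, u ∈ G.valueClass F) ∧
      ∀ f ∈ G.valueClass F, ∃ u ∈ t, ∀ h < G.H, ∀ s, |f h s - u h s| ≤ ε := by
  have hlt : G.coveringNumber F ε < ((N + 1 : ℕ) : ℕ∞) := by
    rw [hcov]; exact_mod_cast Nat.lt_succ_self N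
  simp only [coveringNumber, iInf_lt_iff] at hlt
  obtain ⟨t, ⟨ht, hcover⟩, hcard⟩ := hlt
  exact ⟨t, Nat.lt_succ_iff.1 (by exact_mod_cast hcard), fun u hu => ht hu, hcover⟩

section Perturbation

variable [Nonempty A] [Nonempty B] (G : MarkovGame S A B)

/-- In a difference of squares, the two entries differ by at most `2ε` and their sum is at most `6`.
A cover at scale `1/K` therefore costs at most `12` over the whole run. -/
theorem loss_le_loss_add (x : ℕ → ℕ → S) (a : ℕ → ℕ → A) (b : ℕ → ℕ → B) (k h : ℕ)
    {g g' v v' : S × A × B → ℝ} (hg : ∀ s, |g s| ≤ 1) (hg' : ∀ s, |g' s| ≤ 1)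
    (hv : ∀ s, |v s| ≤ 1) (hv' : ∀ s, |v' s| ≤ 1) {ε : ℝ} (hgε : ∀ s, |g s - g' s| ≤ ε)
    (hvε : ∀ s, |v s - v' s| ≤ ε) :
    G.loss x a b k h g v ≤ G.loss x a b k h g' v' + k * (12 * ε) := by
  have hpt : ∀ s y, (g s - G.reward h s - matrixValue (atState v y)) ^ 2 ≤
      (g' s - G.reward h s - matrixValue (atState v' y)) ^ 2 + 12 * ε := by
    intro s y
    have h₁ := abs_le.1 (hg s)
    have h₂ := abs_le.1 (hg' s)
    have h₃ := G.reward_mem h s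
    have h₄ := abs_le.1 (abs_matrixValue_atState_le hv y)
    have h₅ := abs_le.1 (abs_matrixValue_atState_le hv' y)
    have h₆ : |matrixValue (atState v y) - matrixValue (atState v' y)| ≤ ε :=
      abs_matrixValue_sub_le fun i j => hvε (y, i, j)
    have hdiff : |(g s - G.reward h s - matrixValue (atState v y)) -
        (g' s - G.reward h s - matrixValue (atState v' y))| ≤ 2 * ε := by
      rw [show (g s - G.reward h s - matrixValue (atState v y)) -
        (g' s - G.reward h s - matrixValue (atState v' y)) =
        (g s - g' s) - (matrixValue (atState v y) - matrixValue (atState v' y)) by ring]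
      exact (abs_sub _ _).trans (by linarith [hgε s])
    have hsum : |(g s - G.reward h s - matrixValue (atState v y)) +
        (g' s - G.reward h s - matrixValue (atState v' y))| ≤ 6 := by
      rw [abs_le]
      constructor <;> linarith [h₃.1, h₃.2]
    have hmul := mul_le_mul hdiff hsum (abs_nonneg _) ((abs_nonneg _).trans hdiff)
    rw [← abs_mul] at hmul
    have := (le_abs_self _).trans hmul
    nlinarith
  have hsum := Finset.sum_le_sum fun i (_ : i ∈ Finset.range k) =>
    hpt (x i h, a i h, b i h) (x i (h + 1))
  rw [Finset.sum_add_distrib, Finset.sum_const, Finset.card_range, nsmul_eq_mul] at hsum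
  exact hsum

theorem abs_bellman_sub_le (h : ℕ) {v v' : S × A × B → ℝ} (hv : Measurable v)
    (hv' : Measurable v') (hv1 : ∀ s, |v s| ≤ 1) (hv1' : ∀ s, |v' s| ≤ 1) {ε : ℝ}
    (hvε : ∀ s, |v s - v' s| ≤ ε) (s : S × A × B) :
    |G.bellman h v s - G.bellman h v' s| ≤ ε := by
  rw [bellman, bellman, add_sub_add_left_eq_sub, ← integral_sub
    (integrable_of_abs_le (measurable_matrixValue_atState hv) (abs_matrixValue_atState_le hv1))
    (integrable_of_abs_le (measurable_matrixValue_atState hv') (abs_matrixValue_atState_le hv1'))]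
  exact abs_integral_le_of_abs_le fun y => abs_matrixValue_sub_le fun i j => hvε (y, i, j)

end Perturbation

variable [MeasurableSingletonClass A] [MeasurableSingletonClass B] [Nonempty A] [Nonempty B]

/-- The concentration bound of `IsRun.measure_regression_le` for the pair `(u, v)` on the data of
the first `k` episodes. -/
def RegressionBound (G : MarkovGame S A B) (x : ℕ → ℕ → S) (a : ℕ → ℕ → A) (b : ℕ → ℕ → B)
    (ℓ : ℝ) (k h : ℕ) (u v : S × A × B → ℝ) : Prop :=
  (∑ i ∈ Finset.range k, (u (x i h, a i h, b i h) - G.bellman h v (x i h, a i h, b i h)) ^ 2) / 2 ≤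
    G.loss x a b k h u v - G.loss x a b k h (G.bellman h v) v + 4 * ℓ

section GoodEvent

variable {G : MarkovGame S A B} {F : ℕ → Set (S × A × B → ℝ)} {β ℓ : ℝ} {K k : ℕ}
  {x : ℕ → ℕ → S} {a : ℕ → ℕ → A} {b : ℕ → ℕ → B} {t : Finset (ℕ → S × A × B → ℝ)}

theorem optimalQ_mem_confidenceSet (hN : G.IsNormalized F) (hR : G.Realizable F)
    (ht : ∀ u ∈ t, u ∈ G.valueClass F)
    (hcover : ∀ f ∈ G.valueClass F, ∃ u ∈ t, ∀ h < G.H, ∀ s, |f h s - u h s| ≤ 1 / K)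
    (hk : k < K)
    (hgood : ∀ h < G.H, ∀ u ∈ t, G.RegressionBound x a b ℓ k h (u h) (G.optimalQ (h + 1)))
    (hβ : 12 + 4 * ℓ ≤ β) : G.optimalQ ∈ G.confidenceSet F β x a b k := by
  have hQ := hR.optimalQ_mem
  refine ⟨hQ, fun h hh g hg => ?_⟩
  have hKpos : (0 : ℝ) < K := Nat.cast_pos.2 (by omega)
  -- The competitor `g` lives at one step only; completing it by the optimal functions lets the
  -- cover of the product class approximate it.
  have hf : Function.update G.optimalQ h g ∈ G.valueClass F := by
    refine ⟨fun i hi => ?_, fun i hi => ?_⟩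
    · rcases eq_or_ne i h with rfl | hne
      · rwa [Function.update_self]
      · rw [Function.update_of_ne hne]; exact hQ.1 i hi
    · rw [Function.update_of_ne (by omega)]; exact hQ.2 i hi
  obtain ⟨u, hu, hfu⟩ := hcover _ hf
  have hgu : ∀ s, |u h s - g s| ≤ 1 / K := fun s => by
    have := hfu h hh s
    rwa [Function.update_self, abs_sub_comm] at this
  have h₁ := hgood h hh u hu
  rw [RegressionBound, G.bellman_optimalQ hh] at h₁
  have h₂ : 0 ≤ ∑ i ∈ Finset.range k,
      (u h (x i h, a i h, b i h) - G.optimalQ h (x i h, a i h, b i h)) ^ 2 :=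
    Finset.sum_nonneg fun _ _ => sq_nonneg _
  have h₃ := G.loss_le_loss_add x a b k h (hN.abs_le_one_of_mem (ht u hu) h)
    (fun s => abs_le.2 ((hN h hh g hg).2 s)) (hN.abs_le_one_of_mem hQ (h + 1))
    (hN.abs_le_one_of_mem hQ (h + 1)) hgu (fun s => by rw [sub_self, abs_zero]; positivity)
  have h₄ : (k : ℝ) * (12 * (1 / K)) ≤ 12 := by
    have : (k : ℝ) ≤ K := Nat.cast_le.2 hk.le
    rw [mul_one_div, mul_div_assoc', div_le_iff₀ hKpos]
    linarith
  linarith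

omit [MeasurableSingletonClass A] [MeasurableSingletonClass B] in
-- By completeness `𝒯_h f_{h+1}` is itself a competitor in the confidence set, so the excess loss of
-- `f` over it is at most `β`. Two moves between `f` and its cover cost `24`, doubled to `48`;
-- comparing squared residuals costs another `8`.
theorem sum_sq_residual_le (hN : G.IsNormalized F) (hC : G.Complete F)
    (ht : ∀ u ∈ t, u ∈ G.valueClass F)
    (hcover : ∀ f ∈ G.valueClass F, ∃ u ∈ t, ∀ h < G.H, ∀ s, |f h s - u h s| ≤ 1 / K)
    (hk : k < K) {h : ℕ} (hh : h < G.H)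
    (hgood : ∀ u ∈ t, G.RegressionBound x a b ℓ k h (u h) (u (h + 1)))
    {f : ℕ → S × A × B → ℝ} (hf : f ∈ G.confidenceSet F β x a b k) :
    ∑ i ∈ Finset.range k, G.residual f h (x i h, a i h, b i h) ^ 2 ≤ 2 * β + 8 * ℓ + 56 := by
  have hKpos : (0 : ℝ) < K := Nat.cast_pos.2 (by omega)
  have hkK : (k : ℝ) ≤ K := Nat.cast_le.2 hk.le
  obtain ⟨u, hu, hfu⟩ := hcover f hf.1
  have hfu' : ∀ i s, |f i s - u i s| ≤ 1 / K := fun i s => by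
    rcases lt_or_ge i G.H with hi | hi
    · exact hfu i hi s
    · rw [hf.1.2 i hi, (ht u hu).2 i hi, sub_self, abs_zero]; positivity
  have huf' : ∀ i s, |u i s - f i s| ≤ 1 / K := fun i s => by rw [abs_sub_comm]; exact hfu' i s
  have hT : ∀ s, |G.bellman h (f (h + 1)) s - G.bellman h (u (h + 1)) s| ≤ 1 / K :=
    G.abs_bellman_sub_le h (hN.measurable_of_mem hf.1 _) (hN.measurable_of_mem (ht u hu) _)
      (hN.abs_le_one_of_mem hf.1 _) (hN.abs_le_one_of_mem (ht u hu) _) (hfu' _)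
  have h₁ := hgood u hu
  rw [RegressionBound] at h₁
  have h₂ := G.loss_le_loss_add x a b k h (hN.abs_le_one_of_mem (ht u hu) h)
    (hN.abs_le_one_of_mem hf.1 h) (hN.abs_le_one_of_mem (ht u hu) (h + 1))
    (hN.abs_le_one_of_mem hf.1 (h + 1)) (huf' h) (huf' (h + 1))
  have h₃ := G.loss_le_loss_add x a b k h (hC.abs_bellman_le_one hN hf.1 hh)
    (hC.abs_bellman_le_one hN (ht u hu) hh) (hN.abs_le_one_of_mem hf.1 (h + 1))
    (hN.abs_le_one_of_mem (ht u hu) (h + 1)) hT (hfu' (h + 1))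
  have h₄ := hf.2 h hh _ (hC f hf.1 h hh)
  have h₅ : (k : ℝ) * (12 * (1 / K)) ≤ 12 := by
    rw [mul_one_div, mul_div_assoc', div_le_iff₀ hKpos]
    linarith
  have hpt : ∀ s, G.residual f h s ^ 2 ≤ (u h s - G.bellman h (u (h + 1)) s) ^ 2 + 8 * (1 / K) := by
    intro s
    have hd : |G.residual f h s - G.residual u h s| ≤ 2 * (1 / K) := by
      rw [residual, residual, sub_sub_sub_comm]
      exact (abs_sub _ _).trans (by linarith [hfu' h s, hT s])
    have hs : |G.residual f h s + G.residual u h s| ≤ 4 :=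
      (abs_add_le _ _).trans (by
        linarith [hC.abs_residual_le_two hN hf.1 hh s, hC.abs_residual_le_two hN (ht u hu) hh s])
    have hmul := mul_le_mul hd hs (abs_nonneg _) (by positivity)
    rw [← abs_mul] at hmul
    have := (le_abs_self _).trans hmul
    have hres : G.residual u h s = u h s - G.bellman h (u (h + 1)) s := rfl
    rw [← hres]
    nlinarith
  have hsum := Finset.sum_le_sum fun i (_ : i ∈ Finset.range k) => hpt (x i h, a i h, b i h)
  rw [Finset.sum_add_distrib, Finset.sum_const, Finset.card_range, nsmul_eq_mul] at hsum
  linarith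

omit [MeasurableSingletonClass A] [MeasurableSingletonClass B] [Nonempty A] [Nonempty B] in
theorem sum_abs_residual_le (hN : G.IsNormalized F) (hC : G.Complete F)
    {d : ℕ} (hd : G.minimaxEluderDim F (√(1 / K)) = d) {R : ℝ} (hR : 0 ≤ R) (hK : 0 < K)
    {f : ℕ → ℕ → S × A × B → ℝ} (hf : ∀ k < K, f k ∈ G.valueClass F) {h : ℕ} (hh : h < G.H)
    (hsum : ∀ k < K, ∑ i ∈ Finset.range k, G.residual (f k) h (x i h, a i h, b i h) ^ 2 ≤ R) :
    ∑ k ∈ Finset.range K, |G.residual (f k) h (x k h, a k h, b k h)| ≤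
      2 * √(K * d) + √K + 2 * √(d * R) * √K := by
  have hKpos : (0 : ℝ) < K := Nat.cast_pos.2 hK
  have hdim : distEluderDim (G.residuals F h) (Set.range Measure.dirac) (√(1 / K)) ≤ d := by
    rw [← hd]
    exact le_iSup₂ (f := fun (h : ℕ) (_ : h < G.H) =>
      distEluderDim (G.residuals F h) (Set.range Measure.dirac) (√(1 / K))) h hh
  have hmeas : ∀ g ∈ G.residuals F h, Measurable g := by
    rintro _ ⟨f, hf, rfl⟩
    exact hC.measurable_residual hN hf hh
  have := sum_abs_le_of_distEluderDim_le hmeas (Real.sqrt_pos.2 (by positivity)) hR zero_le_two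
    hdim (fun k => (x k h, a k h, b k h)) (fun k => G.residual (f k) h) K
    (fun k hk => ⟨f k, hf k hk, rfl⟩) (fun k hk => hC.abs_residual_le_two hN (hf k hk) hh _) hsum
  have hKs : (K : ℝ) * √(1 / K) = √K := by
    rw [Real.sqrt_div zero_le_one, Real.sqrt_one, mul_one_div, div_eq_iff (by positivity)]
    exact (Real.mul_self_sqrt hKpos.le).symm
  rwa [hKs] at this

end GoodEvent

variable {G : MarkovGame S A B} {F : ℕ → Set (S × A × B → ℝ)} {β : ℝ} {K : ℕ}
  {Ω : Type z} [mΩ : MeasurableSpace Ω] {P : Measure Ω} [IsProbabilityMeasure P]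
  {𝓗 : ℕ → ℕ → MeasurableSpace Ω}
  {x : ℕ → ℕ → Ω → S} {a : ℕ → ℕ → Ω → A} {b : ℕ → ℕ → Ω → B}
  {f : ℕ → Ω → ℕ → S × A × B → ℝ} {π : ℕ → Ω → Policy S A} {ν : ℕ → Ω → Policy S B}

namespace IsRun

/-- The cover consists of whole tuples, so both families of pairs are indexed by a single element of
`t` and the union bound is linear in the size of the cover. -/
theorem measure_not_regressionBound_le (hrun : G.IsRun F β K P 𝓗 x a b f π ν)
    (hN : G.IsNormalized F) (hR : G.Realizable F) {t : Finset (ℕ → S × A × B → ℝ)}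
    (ht : ∀ u ∈ t, u ∈ G.valueClass F) (ℓ : ℝ) :
    P {ω | ¬ ∀ h < G.H, ∀ k < K, ∀ u ∈ t,
      G.RegressionBound (fun i h => x i h ω) (fun i h => a i h ω) (fun i h => b i h ω) ℓ k h
        (u h) (u (h + 1)) ∧
      G.RegressionBound (fun i h => x i h ω) (fun i h => a i h ω) (fun i h => b i h ω) ℓ k h
        (u h) (G.optimalQ (h + 1))} ≤
      ENNReal.ofReal (2 * G.H * K * t.card * Real.exp (-ℓ)) := by
  have hQ := hR.optimalQ_mem
  let I := (Finset.range G.H ×ˢ Finset.range K) ×ˢ t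
  let bad : (ℕ → S × A × B → ℝ) → (ℕ × ℕ) × (ℕ → S × A × B → ℝ) → Set Ω := fun v j =>
    {ω | ¬ G.RegressionBound (fun i h => x i h ω) (fun i h => a i h ω) (fun i h => b i h ω) ℓ
      j.1.2 j.1.1 (j.2 j.1.1) (v (j.1.1 + 1))}
  have hbad : ∀ v ∈ G.valueClass F, ∀ j ∈ I, P (bad v j) ≤ ENNReal.ofReal (Real.exp (-ℓ)) := by
    rintro v hv ⟨⟨h, k⟩, u⟩ hj
    simp only [I, Finset.mem_product, Finset.mem_range] at hj
    refine (measure_mono fun ω hω => ?_).trans (hrun.measure_regression_le hj.1.1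
      (hN.measurable_of_mem (ht u hj.2) h) (hN.abs_le_one_of_mem (ht u hj.2) h)
      (hN.measurable_of_mem hv (h + 1)) (hN.abs_le_one_of_mem hv (h + 1)) hj.1.2.le ℓ)
    exact not_le.1 hω
  have hsub : {ω | ¬ ∀ h < G.H, ∀ k < K, ∀ u ∈ t,
      G.RegressionBound (fun i h => x i h ω) (fun i h => a i h ω) (fun i h => b i h ω) ℓ k h
        (u h) (u (h + 1)) ∧
      G.RegressionBound (fun i h => x i h ω) (fun i h => a i h ω) (fun i h => b i h ω) ℓ k h
        (u h) (G.optimalQ (h + 1))} ⊆ ⋃ j ∈ I, (bad j.2 j ∪ bad G.optimalQ j) := by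
    intro ω hω
    by_contra hcon
    refine hω fun h hh k hk u hu => ?_
    have hj : ((h, k), u) ∈ I := by
      simp only [I, Finset.mem_product, Finset.mem_range]
      exact ⟨⟨hh, hk⟩, hu⟩
    constructor
    · by_contra hb
      exact hcon (Set.mem_biUnion hj (Or.inl hb))
    · by_contra hb
      exact hcon (Set.mem_biUnion hj (Or.inr hb))
  calc _ ≤ ∑ j ∈ I, P (bad j.2 j ∪ bad G.optimalQ j) :=
        (measure_mono hsub).trans (measure_biUnion_finset_le _ _)
    _ ≤ ∑ j ∈ I, ENNReal.ofReal (2 * Real.exp (-ℓ)) := by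
        refine Finset.sum_le_sum fun j hj => (measure_union_le _ _).trans ?_
        rw [two_mul, ENNReal.ofReal_add (Real.exp_pos _).le (Real.exp_pos _).le]
        have hjt : j.2 ∈ t := (Finset.mem_product.1 hj).2
        exact add_le_add (hbad _ (ht _ hjt) j hj) (hbad _ hQ j hj)
    _ = _ := by
        rw [Finset.sum_const, nsmul_eq_mul, ← ENNReal.ofReal_natCast,
          ← ENNReal.ofReal_mul (Nat.cast_nonneg _)]
        congr 1
        simp only [I, Finset.card_product, Finset.card_range]
        push_cast
        ring

omit [IsProbabilityMeasure P] in
theorem regret_le (hrun : G.IsRun F β K P 𝓗 x a b f π ν) (hN : G.IsNormalized F)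
    (hR : G.Realizable F) (hC : G.Complete F) {t : Finset (ℕ → S × A × B → ℝ)}
    (ht : ∀ u ∈ t, u ∈ G.valueClass F)
    (hcover : ∀ f ∈ G.valueClass F, ∃ u ∈ t, ∀ h < G.H, ∀ s, |f h s - u h s| ≤ 1 / K)
    {d : ℕ} (hd : G.minimaxEluderDim F (√(1 / K)) = d) (hK : 0 < K) {ℓ : ℝ} (hℓ : 0 ≤ ℓ)
    (hβ : 12 + 4 * ℓ ≤ β) {ω : Ω}
    (hgood : ∀ h < G.H, ∀ k < K, ∀ u ∈ t,
      G.RegressionBound (fun i h => x i h ω) (fun i h => a i h ω) (fun i h => b i h ω) ℓ k h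
        (u h) (u (h + 1)) ∧
      G.RegressionBound (fun i h => x i h ω) (fun i h => a i h ω) (fun i h => b i h ω) ℓ k h
        (u h) (G.optimalQ (h + 1)))
    (hmart : ∑ k ∈ Finset.range K,
        (G.expectedSum (G.residual (f k ω)) (π k ω) (ν k ω) G.H 0 (x k 0 ω) -
          ∑ h ∈ Finset.range G.H, G.residual (f k ω) h (x k h ω, a k h ω, b k h ω)) ≤
      4 * G.H * √(2 * K * ℓ)) :
    G.regret K (fun k => x k 0 ω) (fun k => π k ω) (fun k => ν k ω) ≤
      G.H * (2 * √(K * d) + √K + 2 * √(d * (2 * β + 8 * ℓ + 56)) * √K + 4 * √(2 * K * ℓ)) := by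
  have h₁ : ∀ k ∈ Finset.range K,
      G.Vstar 0 (x k 0 ω) - G.V (π k ω) (ν k ω) 0 (x k 0 ω) ≤
      G.expectedSum (G.residual (f k ω)) (π k ω) (ν k ω) G.H 0 (x k 0 ω) := by
    intro k hk
    have hk := Finset.mem_range.1 hk
    have hopt := hrun.optimistic k hk ω _ (optimalQ_mem_confidenceSet hN hR ht hcover hk
      (fun h hh u hu => (hgood h hh k hk u hu).2) hβ)
    rw [← G.Vstar_eq_matrixValue_optimalQ] at hopt
    have := matrixValue_sub_le_expectedSum_residual hC hN (hrun.mem_valueClass hk ω)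
      (hrun.maximin k hk ω) (ν k ω) G.H 0 rfl (x k 0 ω)
    rw [V, Nat.sub_zero]
    linarith
  have h₂ : ∑ k ∈ Finset.range K, ∑ h ∈ Finset.range G.H,
      G.residual (f k ω) h (x k h ω, a k h ω, b k h ω) ≤
      G.H * (2 * √(K * d) + √K + 2 * √(d * (2 * β + 8 * ℓ + 56)) * √K) := by
    rw [Finset.sum_comm]
    refine (Finset.sum_le_sum (g := fun _ => 2 * √(K * d) + √K +
      2 * √(d * (2 * β + 8 * ℓ + 56)) * √K) fun h hh => ?_).trans_eq
      (by rw [Finset.sum_const, Finset.card_range, nsmul_eq_mul])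
    have hh := Finset.mem_range.1 hh
    refine (Finset.sum_le_sum fun k _ => le_abs_self _).trans ?_
    exact sum_abs_residual_le (x := fun i h => x i h ω) (a := fun i h => a i h ω)
      (b := fun i h => b i h ω) hN hC hd (by linarith) hK
      (fun k hk => hrun.mem_valueClass hk ω) hh fun k hk =>
        sum_sq_residual_le hN hC ht hcover hk hh (fun u hu => (hgood h hh k hk u hu).1)
          (hrun.mem_confidenceSet k hk ω)
  rw [Finset.sum_sub_distrib] at hmart
  have h₃ := Finset.sum_le_sum h₁
  rw [regret]
  linarith

end IsRun

end MarkovGame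

/-! ### The main theorem: choice of constants and probabilities. -/

theorem mainTheorem1 :
    ∃ c₀ : ℝ, 0 < c₀ ∧ ∀ c : ℝ, c₀ ≤ c → ∃ C : ℝ, 0 < C ∧
      ∀ (S : Type u) (A : Type v) (B : Type w) [MeasurableSpace S]
        [MeasurableSpace A] [MeasurableSingletonClass A] [Fintype A] [Nonempty A]
        [MeasurableSpace B] [MeasurableSingletonClass B] [Fintype B] [Nonempty B]
        (G : MarkovGame S A B) (F : ℕ → Set (S × A × B → ℝ)),
        G.IsNormalized F → G.Realizable F → G.Complete F →
      ∀ (K : ℕ) (p : ℝ), 0 < p → p < 1 → 2 * p ≤ G.H * K →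
      ∀ (N d : ℕ), G.coveringNumber F (1 / K) = N → G.minimaxEluderDim F (Real.sqrt (1 / K)) = d →
      ∀ (Ω : Type z) [MeasurableSpace Ω] (P : Measure Ω) [IsProbabilityMeasure P]
        (𝓗 : ℕ → ℕ → MeasurableSpace Ω)
        (x : ℕ → ℕ → Ω → S) (a : ℕ → ℕ → Ω → A) (b : ℕ → ℕ → Ω → B)
        (f : ℕ → Ω → ℕ → S × A × B → ℝ) (π : ℕ → Ω → Policy S A) (ν : ℕ → Ω → Policy S B),
        G.IsRun F (c * Real.log (G.H * K * N / p)) K P 𝓗 x a b f π ν →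
        P {ω | C * (G.H * Real.sqrt (K * max 1 (d : ℝ) * Real.log (G.H * K * N / p))) <
            G.regret K (fun k => x k 0 ω) (fun k => π k ω) (fun k => ν k ω)}
          ≤ ENNReal.ofReal p := by
  -- `30` makes `12 + 4ℓ ≤ c L` below. In `C`, the `18` is `4 + 2 + 12` from the dimension,
  -- resolution and martingale terms; the root comes from the confidence width.
  refine ⟨30, by norm_num, fun c hc => ⟨18 + 2 * √(2 * c + 108), by positivity, ?_⟩⟩
  intro S A B _ _ _ _ _ _ _ _ _ G F hN hR hC K p hp hp1 hpHK N d hcov hd Ω _ P _ 𝓗 x a b f π ν hrun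
  -- The condition `2p ≤ HK` encodes `H, K ≥ 1` and `p ≤ 1/2` when `H = K = 1`; it keeps the
  -- logarithm away from zero, at least `log 2`.
  have hHK : (0 : ℝ) < G.H * K := by linarith
  have hH : 0 < G.H := Nat.pos_of_ne_zero fun h => by simp [h] at hHK
  have hK : 0 < K := Nat.pos_of_ne_zero fun h => by simp [h] at hHK
  have hHK1 : (1 : ℝ) ≤ G.H * K := by exact_mod_cast Nat.mul_pos hH hK
  have hHpos : (0 : ℝ) < G.H := Nat.cast_pos.2 hH
  have hKpos : (0 : ℝ) < K := Nat.cast_pos.2 hK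
  obtain ⟨t, htN, ht, hcover⟩ := MarkovGame.exists_cover_of_coveringNumber_eq hcov
  -- Realizability makes the class nonempty, so `N ≥ 1`.
  obtain ⟨u₀, hu₀, -⟩ := hcover _ hR.optimalQ_mem
  have hN1 : 1 ≤ N := (Finset.card_pos.2 ⟨u₀, hu₀⟩).trans_le htN
  have hNpos : (1 : ℝ) ≤ N := by exact_mod_cast hN1
  set L : ℝ := Real.log (G.H * K * N / p) with hL
  have hL2 : Real.log 2 ≤ L := by
    refine Real.log_le_log two_pos ?_
    rw [le_div_iff₀ hp]
    nlinarith
  have hlog2 := Real.log_two_gt_d9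
  -- Then `exp (-ℓ) = p / (4HKN)`: the regression events fail with probability at most `p/2` and the
  -- martingale event with at most `p/4`.
  set ℓ : ℝ := Real.log 4 + L with hℓ_def
  have hlog4 : Real.log 4 = 2 * Real.log 2 := by
    rw [show (4 : ℝ) = 2 ^ 2 by norm_num, Real.log_pow]; norm_num
  have hℓ : 0 ≤ ℓ := by linarith
  have hℓL : ℓ ≤ 3 * L := by linarith
  have hexp : Real.exp (-ℓ) = p / (4 * (G.H * K * N)) := by
    rw [Real.exp_neg, hℓ_def, Real.exp_add, Real.exp_log (by norm_num), hL,
      Real.exp_log (by positivity)]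
    field_simp
  have hβ : 12 + 4 * ℓ ≤ c * L := by nlinarith
  have hbad₁ := hrun.measure_not_regressionBound_le hN hR ht ℓ
  have hbad₂ := hrun.measure_expectedSum_residual_gt_le hC hN hH hK hℓ
  refine (measure_mono fun ω hω => ?_).trans ((measure_union_le _ _).trans
    ((add_le_add hbad₁ hbad₂).trans ?_))
  · by_contra hcon
    rw [Set.mem_union, not_or] at hcon
    have hreg := hrun.regret_le hN hR hC ht hcover hd hK hℓ hβ (not_not.1 hcon.1)
      (not_lt.1 hcon.2)
    refine absurd hω (not_lt.2 (hreg.trans ?_))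
    set m : ℝ := max 1 (d : ℝ) with hm
    have hm1 : 1 ≤ m := le_max_left _ _
    have hmd : (d : ℝ) ≤ m := le_max_right _ _
    have hLpos : 0 < L := by linarith
    have hKm : (K : ℝ) ≤ K * m := le_mul_of_one_le_right hKpos.le hm1
    have hKdm : (K : ℝ) * d ≤ K * m := by gcongr
    -- As `L ≥ log 2 > 1/2`, terms without a logarithm are absorbed.
    have hKmL : (K : ℝ) * m ≤ 2 * (K * m * L) := by nlinarith [mul_pos hKpos (by linarith : 0 < m)]
    have hKL : (K : ℝ) * L ≤ K * m * L := by gcongr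
    have hZ : 0 ≤ (K : ℝ) * m * L := by positivity
    have e₁ : √(K * d) ≤ 2 * √(K * m * L) := Real.sqrt_le_mul_sqrt (by norm_num) (by linarith)
    have e₂ : √(K : ℝ) ≤ 2 * √(K * m * L) := Real.sqrt_le_mul_sqrt (by norm_num) (by linarith)
    have e₃ : √(d * (2 * (c * L) + 8 * ℓ + 56)) * √K ≤ √(2 * c + 108) * √(K * m * L) := by
      rw [← Real.sqrt_mul (by positivity)]
      refine Real.sqrt_le_mul_sqrt (Real.sqrt_nonneg _) ?_
      rw [Real.sq_sqrt (by linarith)]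
      have h₁ : 2 * (c * L) + 8 * ℓ + 56 ≤ (2 * c + 108) * L := by linarith
      calc (d : ℝ) * (2 * (c * L) + 8 * ℓ + 56) * K ≤ m * ((2 * c + 108) * L) * K := by gcongr
        _ = _ := by ring
    have e₄ : √(2 * K * ℓ) ≤ 3 * √(K * m * L) := by
      refine Real.sqrt_le_mul_sqrt (by norm_num) ?_
      nlinarith
    calc G.H * (2 * √(K * d) + √K + 2 * √(d * (2 * (c * L) + 8 * ℓ + 56)) * √K + 4 * √(2 * K * ℓ))
        ≤ G.H * (2 * (2 * √(K * m * L)) + 2 * √(K * m * L) +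
          2 * (√(2 * c + 108) * √(K * m * L)) + 4 * (3 * √(K * m * L))) := by
          rw [mul_assoc 2]
          gcongr
      _ = _ := by ring
  · rw [← ENNReal.ofReal_add (by positivity) (Real.exp_pos _).le, hexp]
    refine ENNReal.ofReal_le_ofReal ?_
    have htN' : (t.card : ℝ) ≤ N := by exact_mod_cast htN
    have hD : (1 : ℝ) ≤ G.H * K * N := one_le_mul_of_one_le_of_one_le hHK1 hNpos
    calc 2 * G.H * K * t.card * (p / (4 * (G.H * K * N))) + p / (4 * (G.H * K * N))
        ≤ 2 * G.H * K * N * (p / (4 * (G.H * K * N))) + p / (4 * 1) := by gcongr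
      _ = p / 2 + p / 4 := by field_simp; ring
      _ ≤ p := by linarith
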